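/- **Setting.** For $x,y\in\{0,1\}^n$ let $\Delta(x,y)$ be their Hamming distance. For real $c>0$, the partial function $\mathrm{GHD}_{c,n}$ on $\{0,1\}^n\times\{0,1\}^n$ equals $1$ if $\Delta(x,y)\ge n/2+c\sqrt n$, equals $0$ if $\Delta(x,y)\le n/2-c\sqrt n$, and is undefined ($\star$) otherwise; every output bit matches $\star$. A deterministic $k$-round protocol consists of exactly $k$ messages, sent alternately by Alice (who holds $x$ and starts) and Bob (who holds $y$); each message depends on the sender's input and the earlier messages, and the recipient of the last message announces the output bit (if $k=0$, Alice announces it). A randomized (public-coin) $k$-round protocol is a probability distribution on deterministic $k$-round protocols; it has error $\varepsilon$ if on every input $(x,y)$ its output fails to match the function value with probability at most $\varepsilon$. A deterministic protocol has distributional error at most $\varepsilon$ under an input distribution $\rho$ if its output fails to match the function value with $\rho$-probability at most $\varepsilon$. Let $\mu_{c,n}$ be the uniform distribution on the pairs $(x,y)$ with $|\Delta(x,y)-n/2|\ge c\sqrt n$. **Theorem (Multi-round Lower Bound).** Let $c_0>0$. In the following, $n,k,s\ge 0$ are integers and $0<c\le c_0$; all messages have at most $s$ bits; and we exclude degenerate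 cases by assuming that $\mathrm{GHD}_{c,n}$ is non-trivial, in the sense that $2c\le\sqrt n$, or that $k\ge1$ and $s\ge1$. There is a constant $C$, depending only on $c_0$, such that the following holds. 1. If there is a randomized $k$-round protocol for $\mathrm{GHD}_{c,n}$ with error $\frac13$, then $s\ge n/2^{Ck^2}$. 2. For every $k$ there is $\varepsilon>0$, depending only on $c_0$ and $k$, such that if there is a deterministic $k$-round protocol for $\mathrm{GHD}_{c,n}$ with distributional error at most $\varepsilon$ under the uniform distribution on $\{0,1\}^n\times\{0,1\}^n$ or under $\mu_{c,n}$, then $s\ge n/2^{Ck^2}$. In particular, for every $K$ there are $\delta,\varepsilon>0$, depending only on $c_0$ and $K$, such that $s\ge\delta n$ whenever $k\le K$ and there is a protocol as in 1, or one as in 2 with this $\varepsilon$. (If there is no pair with $|\Delta(x,y)-n/2|\ge c\sqrt n$, every protocol is counted as having error $0$ under $\mu_{c,n}$.) -/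

import Mathlib

open ProbabilityTheory MeasureTheory
open scoped ENNReal

/-- Boolean strings of length `n`. -/
abbrev BitString (n : ℕ) : Type := Fin n → Bool

/-- The Gap-Hamming-Distance partial function on `n`-bit inputs with thresholds
`n / 2 ± c * √n`; the undefined value `⋆` is `none`. -/
noncomputable def ghd (c : ℝ) (n : ℕ) (x y : BitString n) : Option Bool :=
  if (n : ℝ) / 2 + c * √(n : ℝ) ≤ (hammingDist x y : ℝ) then some true
  else if (hammingDist x y : ℝ) ≤ (n : ℝ) / 2 - c * √(n : ℝ) then some false
  else none

/-- The output bit `b` matches the value `v` of a partial function; `⋆` matches both bits. -/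
def Matches (b : Bool) (v : Option Bool) : Prop := v = none ∨ v = some b

/-- The strings `x` and `y` are `c`-near-orthogonal. -/
def NearOrthogonal (c : ℝ) {n : ℕ} (x y : BitString n) : Prop :=
  |(hammingDist x y : ℝ) - (n : ℝ) / 2| < c * √(n : ℝ)

/-- Messages of at most `s` bits: a length `l ≤ s` together with a bit string of length `l`. -/
abbrev Message (s : ℕ) : Type := Σ l : Fin (s + 1), BitString l

/-- Deterministic two-party protocols on `n`-bit inputs with exactly `k` messages, each of at most
`s` bits, as protocol trees. The player whose turn it is sends a message that depends on this
player's own input (and, through the position in the tree, on all earlier messages); after that it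
is the other player's turn. When no message is left, the player whose turn it is, that is, the
recipient of the last message, announces the output. -/
inductive Protocol (n s : ℕ) : ℕ → Type
  | output (out : BitString n → Bool) : Protocol n s 0
  | round {k : ℕ} (msg : BitString n → Message s) (next : Message s → Protocol n s k) :
      Protocol n s (k + 1)

/-- The output of a protocol; the first argument is the input of the player whose turn it is, the
second one is the input of the other player. For a whole protocol, these are the input `x` of
Alice, who sends the first message, and the input `y` of Bob. -/
def Protocol.eval {n s : ℕ} : {k : ℕ} → Protocol n s k → BitString n → BitString n → Bool
  | _, .output out, own, _ => out own
  | _, .round msg next, own, other => (next (msg own)).eval other own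

/-- A randomized protocol with public coins: the public random string selects a deterministic
protocol, so that it is a probability distribution on deterministic protocols. -/
abbrev RandomizedProtocol (n s k : ℕ) : Type := PMF (Protocol n s k)

/-- On every input, the randomized protocol `P` for `f` errs with probability at most `ε`. -/
def RandomizedProtocol.HasError {n s k : ℕ} (P : RandomizedProtocol n s k)
    (f : BitString n → BitString n → Option Bool) (ε : ℝ≥0∞) : Prop :=
  ∀ x y : BitString n,
    PMF.toOuterMeasure P {Q : Protocol n s k | ¬ Matches (Q.eval x y) (f x y)} ≤ ε

/-- The deterministic protocol `P` for `f` has distributional error at most `ε` under the input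
distribution `ρ`. -/
def Protocol.HasDistError {n s k : ℕ} (P : Protocol n s k)
    (f : BitString n → BitString n → Option Bool) (ρ : Measure (BitString n × BitString n))
    (ε : ℝ≥0∞) : Prop :=
  ρ {p : BitString n × BitString n | ¬ Matches (P.eval p.1 p.2) (f p.1 p.2)} ≤ ε

/-- The uniform distribution on all pairs of `n`-bit strings. -/
noncomputable def uniformInputs (n : ℕ) : Measure (BitString n × BitString n) :=
  uniformOn Set.univ

/-- The uniform distribution on the pairs that are not `c`-near-orthogonal (if there are such
pairs; otherwise it is the zero measure). -/
noncomputable def muInputs (c : ℝ) (n : ℕ) : Measure (BitString n × BitString n) :=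
  uniformOn {p : BitString n × BitString n | ¬ NearOrthogonal c p.1 p.2}

/-! The proof gives more than is claimed: apart from protocols without communication, the total
length `k * s` must be linear in `n`, and `k ≤ 2 ^ (k ^ 2)` turns this into the stated bound.
Instead of the Hamming distance one works with the inner product ⟨x, y⟩ = n - 2Δ(x, y) of sign
vectors. A short transcript cuts the input pairs into few combinatorial rectangles, so the question
is how ⟨x, y⟩ behaves on a large rectangle A × B.

Anti-concentration (`card_signInner_far_ge`): a dense set A contains m rows of a square matrix X in
which, even after deleting any few rows, many columns can be chosen one by one, each far from the
span of those chosen before. Then Xy, a random signed sum of the columns, is exponentially unlikely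
to be close to a given vector. So few y can have ⟨x, y⟩ near one value v for almost all rows x, and
B is too large to consist of such y. Hence a short transcript does not determine ⟨x, y⟩ up to a
small multiple of √m on almost all pairs (`card_signInner_approx_ge`).

Reduction (`exists_threshold_simulation`): from m-bit strings, sample N coordinates, with N a large
constant times m, and mask them by shared random bits. A gap-Hamming function on N bits with few
errors then decides whether ⟨x, y⟩ is above or below a threshold, which padding coordinates move to
any wanted place. Constantly many thresholds locate ⟨x, y⟩ up to √m / 64, a contradiction
(`exists_lt_card_gapErrors`). This excludes small distributional error; error 1/3 is first reduced
by a majority vote among constantly many deterministic protocols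
(`PMF.exists_tuple_card_majority_le`). -/

/-! ### Small-ball estimates for signed sums of vectors -/

section Geometry

variable {E : Type*} [NormedAddCommGroup E] [InnerProductSpace ℝ E] {ι : Type*}

/-- The span of `U` and the vectors `c j` with `j` in a list. -/
def chainSpan (c : ι → E) (U : Submodule ℝ E) : List ι → Submodule ℝ E
  | [] => U
  | j :: l => chainSpan c U l ⊔ Submodule.span ℝ {c j}

theorem chainSpan_eq (c : ι → E) (U : Submodule ℝ E) (l : List ι) :
    chainSpan c U l = U ⊔ Submodule.span ℝ (c '' {j | j ∈ l}) := by
  induction l with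
  | nil => simp [chainSpan]
  | cons j l ih =>
    have : (c '' {i | i ∈ j :: l}) = {c j} ∪ c '' {i | i ∈ l} := by
      ext x; simp [eq_comm]
    rw [chainSpan, ih, this, Submodule.span_union, sup_assoc, sup_comm (Submodule.span ℝ {c j})]

variable [FiniteDimensional ℝ E]

/-- The norm of `Uᗮ.starProjection v` plays the role of the distance of `v` from `U` throughout. -/
theorem norm_orthogonal_starProjection_le (U : Submodule ℝ E) {u : E} (hu : u ∈ U) (v : E) :
    ‖Uᗮ.starProjection v‖ ≤ ‖v - u‖ := by
  have h : Uᗮ.starProjection (v - u) = Uᗮ.starProjection v := by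
    rw [map_sub, Submodule.starProjection_orthogonal_apply_eq_zero hu, sub_zero]
  rw [← h]
  exact Submodule.norm_starProjection_apply_le _ _

/-- Adding `± c` to `v`: at least one of the two points is far from `U`, compared to the distance
of `v` from `U ⊔ span c`. -/
theorem exp_neg_dist_add_exp_neg_dist_le (U : Submodule ℝ E) (c v : E) {a τ : ℝ} (ha : 0 ≤ a)
    (hτ : 0 < τ) (h : τ ≤ ‖Uᗮ.starProjection c‖) :
    Real.exp (-a * ‖Uᗮ.starProjection (v + c)‖ ^ 2) +
        Real.exp (-a * ‖Uᗮ.starProjection (v - c)‖ ^ 2) ≤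
      (1 + Real.exp (-a * τ ^ 2)) *
        Real.exp (-a * ‖(U ⊔ Submodule.span ℝ {c})ᗮ.starProjection v‖ ^ 2) := by
  set q := Uᗮ.starProjection v with hq
  set g := Uᗮ.starProjection c with hg
  have hg0 : 0 < ‖g‖ := hτ.trans_le h
  -- Splitting off the component of `q` along `g` gives `v ± c` the squared distances `‖q'‖ ^ 2 + (α
  -- ± 1) ^ 2 * ‖g‖ ^ 2` from `U`. One of the factors `(α ± 1) ^ 2` is at least 1, depending on the
  -- sign of `α`.
  set α : ℝ := inner ℝ q g / ‖g‖ ^ 2 with hα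
  set q' := q - α • g with hq'
  have horth : inner ℝ q' g = 0 := by
    rw [hq', inner_sub_left, inner_smul_left, real_inner_self_eq_norm_sq, hα]
    simp only [conj_trivial]
    field_simp
    ring
  have hle : ‖(U ⊔ Submodule.span ℝ {c})ᗮ.starProjection v‖ ≤ ‖q'‖ := by
    have hmem : α • c + U.starProjection (v - α • c) ∈ U ⊔ Submodule.span ℝ {c} := by
      refine add_mem (Submodule.mem_sup_right ?_) (Submodule.mem_sup_left ?_)
      · exact Submodule.smul_mem _ _ (Submodule.mem_span_singleton_self c)
      · exact U.starProjection_apply_mem _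
    refine (norm_orthogonal_starProjection_le _ hmem v).trans_eq ?_
    congr 1
    have h1 : Uᗮ.starProjection (v - α • c) = (v - α • c) - U.starProjection (v - α • c) := by
      rw [Submodule.starProjection_orthogonal]; rfl
    rw [hq', hq, hg, ← map_smul, ← map_sub, h1]
    abel
  have hnorm : ∀ x : ℝ, ‖q' + x • g‖ ^ 2 = ‖q'‖ ^ 2 + x ^ 2 * ‖g‖ ^ 2 := by
    intro x
    rw [norm_add_sq_real, inner_smul_right, horth, norm_smul, mul_pow, Real.norm_eq_abs, sq_abs]
    ring
  have hp : ‖Uᗮ.starProjection (v + c)‖ ^ 2 = ‖q'‖ ^ 2 + (1 + α) ^ 2 * ‖g‖ ^ 2 := by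
    rw [map_add, ← hq, ← hg, ← hnorm, hq']
    congr 2
    module
  have hm : ‖Uᗮ.starProjection (v - c)‖ ^ 2 = ‖q'‖ ^ 2 + (α - 1) ^ 2 * ‖g‖ ^ 2 := by
    rw [map_sub, ← hq, ← hg, ← hnorm, hq']
    congr 2
    module
  have hD : ‖(U ⊔ Submodule.span ℝ {c})ᗮ.starProjection v‖ ^ 2 ≤ ‖q'‖ ^ 2 := by gcongr
  have hT : τ ^ 2 ≤ ‖g‖ ^ 2 := by gcongr
  set D := ‖(U ⊔ Submodule.span ℝ {c})ᗮ.starProjection v‖ ^ 2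
  have key : ∀ x : ℝ, Real.exp (-a * (‖q'‖ ^ 2 + x ^ 2 * ‖g‖ ^ 2)) ≤ Real.exp (-a * D) := by
    intro x
    apply Real.exp_le_exp.2
    have : D ≤ ‖q'‖ ^ 2 + x ^ 2 * ‖g‖ ^ 2 := by nlinarith [mul_nonneg (sq_nonneg x) (sq_nonneg ‖g‖)]
    nlinarith
  have key2 : ∀ x : ℝ, 1 ≤ x ^ 2 → Real.exp (-a * (‖q'‖ ^ 2 + x ^ 2 * ‖g‖ ^ 2)) ≤
      Real.exp (-a * τ ^ 2) * Real.exp (-a * D) := by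
    intro x hx
    rw [← Real.exp_add]
    apply Real.exp_le_exp.2
    have : D + τ ^ 2 ≤ ‖q'‖ ^ 2 + x ^ 2 * ‖g‖ ^ 2 := by nlinarith [sq_nonneg ‖g‖]
    nlinarith
  rw [hp, hm]
  rcases le_total 0 α with h0 | h0
  · have := key2 (1 + α) (by nlinarith)
    have := key (α - 1)
    linarith
  · have := key2 (α - 1) (by nlinarith)
    have := key (1 + α)
    linarith

/-- Every vector of the list has distance at least `τ` from the span of `U` and the vectors that
come after it. -/
def IsSpreadOut (c : ι → E) (τ : ℝ) (U : Submodule ℝ E) : List ι → Prop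
  | [] => True
  | j :: l => τ ≤ ‖(chainSpan c U l)ᗮ.starProjection (c j)‖ ∧ IsSpreadOut c τ U l

theorem finrank_chainSpan_le (c : ι → E) (U : Submodule ℝ E) (l : List ι) :
    Module.finrank ℝ (chainSpan c U l) ≤ Module.finrank ℝ U + l.length := by
  induction l with
  | nil => exact le_rfl
  | cons j l ih =>
    have h1 := Submodule.finrank_add_le_finrank_add_finrank (chainSpan c U l)
      (Submodule.span ℝ {c j})
    have h2 : Module.finrank ℝ (Submodule.span ℝ {c j}) ≤ 1 := finrank_span_le_card ({c j} : Set E)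
      |>.trans (by simp)
    change Module.finrank ℝ ↥(chainSpan c U l ⊔ Submodule.span ℝ {c j}) ≤ _
    rw [List.length_cons]
    omega

/-- A greedy choice yields a chain of the wanted length, or a shorter one such that all vectors
are close to its span. -/
theorem exists_isSpreadOut_or (c : ι → E) (τ : ℝ) (U : Submodule ℝ E) (p : ℕ) :
    (∃ l : List ι, l.length = p ∧ IsSpreadOut c τ U l) ∨
      ∃ l : List ι, l.length < p ∧ ∀ j, ‖(chainSpan c U l)ᗮ.starProjection (c j)‖ < τ := by
  induction p with
  | zero => exact Or.inl ⟨[], rfl, trivial⟩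
  | succ p ih =>
    rcases ih with ⟨l, hl, hc⟩ | ⟨l, hl, hc⟩
    · by_cases h : ∃ j, τ ≤ ‖(chainSpan c U l)ᗮ.starProjection (c j)‖
      · obtain ⟨j, hj⟩ := h
        exact Or.inl ⟨j :: l, by simp [hl], hj, hc⟩
      · push Not at h
        exact Or.inr ⟨l, by omega, h⟩
    · exact Or.inr ⟨l, by omega, hc⟩

/-- The sign `±1` of a bit. -/
def sgn (b : Bool) : ℝ := if b then -1 else 1

theorem sgn_mul_self (b : Bool) : sgn b * sgn b = 1 := by cases b <;> simp [sgn]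

theorem sgn_not (b : Bool) : sgn (!b) = -sgn b := by cases b <;> simp [sgn]

theorem abs_sgn (b : Bool) : |sgn b| = 1 := by cases b <;> simp [sgn]

variable [Fintype ι] [DecidableEq ι]

theorem sum_update_not (F : (ι → Bool) → ℝ) (j : ι) :
    ∑ y, F (Function.update y j (!y j)) = ∑ y, F y := by
  have hinv : Function.Involutive fun y : ι → Bool ↦ Function.update y j (!y j) := by
    intro y
    ext i
    by_cases h : i = j
    · subst h; simp
    · simp [h]
  exact Equiv.sum_comp hinv.toPerm F

/-- Each vector of the chain is absorbed into the subspace at the gain of a factor `(1 + exp (-a * τ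
^ 2)) / 2`: pair every `y` with its flip at `j` and apply `exp_neg_dist_add_exp_neg_dist_le` to the
midpoint. -/
theorem sum_exp_neg_dist_le (c : ι → E) (w : E) (U : Submodule ℝ E) {a τ : ℝ} (ha : 0 ≤ a)
    (hτ : 0 < τ) (l : List ι) (hl : IsSpreadOut c τ U l) :
    2 ^ l.length * ∑ y : ι → Bool,
        Real.exp (-a * ‖Uᗮ.starProjection (∑ j, sgn (y j) • c j + w)‖ ^ 2) ≤
      (1 + Real.exp (-a * τ ^ 2)) ^ l.length * ∑ y : ι → Bool,
        Real.exp (-a * ‖(chainSpan c U l)ᗮ.starProjection (∑ j, sgn (y j) • c j + w)‖ ^ 2) := by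
  induction l with
  | nil => simp [chainSpan]
  | cons j l ih =>
    set F : Submodule ℝ E → (ι → Bool) → ℝ := fun V y ↦
      Real.exp (-a * ‖Vᗮ.starProjection (∑ j, sgn (y j) • c j + w)‖ ^ 2) with hF
    set V := chainSpan c U l with hV
    have step : 2 * ∑ y, F V y ≤
        (1 + Real.exp (-a * τ ^ 2)) * ∑ y, F (V ⊔ Submodule.span ℝ {c j}) y := by
      rw [two_mul]
      nth_rewrite 2 [← sum_update_not _ j]
      rw [← Finset.sum_add_distrib, Finset.mul_sum]
      refine Finset.sum_le_sum fun y _ ↦ ?_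
      set z := ∑ i, sgn (y i) • c i + w with hz
      have h1 : ∑ i, sgn (Function.update y j (!y j) i) • c i + w = z - (2 * sgn (y j)) • c j := by
        have : ∀ i, sgn (Function.update y j (!y j) i) • c i =
            sgn (y i) • c i - (if i = j then (2 * sgn (y j)) • c j else 0) := by
          intro i
          by_cases h : i = j
          · subst h
            simp only [Function.update_self, sgn_not, if_true]
            module
          · simp [h]
        rw [Finset.sum_congr rfl fun i _ ↦ this i, Finset.sum_sub_distrib]
        simp [hz]
        abel
      have hspan : Submodule.span ℝ {sgn (y j) • c j} = Submodule.span ℝ {c j} :=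
        Submodule.span_singleton_smul_eq
          (IsUnit.of_mul_eq_one _ (sgn_mul_self (y j))) _
      have h2 := exp_neg_dist_add_exp_neg_dist_le V (sgn (y j) • c j) (z - sgn (y j) • c j) ha hτ
        (by rw [map_smul, norm_smul, Real.norm_eq_abs, abs_sgn, one_mul]; exact hl.1)
      simp only [hspan] at h2
      rw [map_sub (V ⊔ Submodule.span ℝ {c j})ᗮ.starProjection z,
        Submodule.starProjection_orthogonal_apply_eq_zero (v := sgn (y j) • c j)
        (Submodule.mem_sup_right
          (Submodule.smul_mem _ _ (Submodule.mem_span_singleton_self _))), sub_zero] at h2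
      have h3 : z - sgn (y j) • c j + sgn (y j) • c j = z := by abel
      have h4 : z - sgn (y j) • c j - sgn (y j) • c j = z - (2 * sgn (y j)) • c j := by
        rw [two_mul, add_smul]
        abel
      rw [h3, h4] at h2
      simp only [hF, h1]
      exact h2
    have ih' := ih hl.2
    simp only [List.length_cons, pow_succ]
    change 2 ^ l.length * 2 * ∑ y, F U y ≤ (1 + Real.exp (-a * τ ^ 2)) ^ l.length *
      (1 + Real.exp (-a * τ ^ 2)) * ∑ y, F (V ⊔ Submodule.span ℝ {c j}) y
    calc 2 ^ l.length * 2 * ∑ y, F U y = 2 * (2 ^ l.length * ∑ y, F U y) := by ring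
      _ ≤ 2 * ((1 + Real.exp (-a * τ ^ 2)) ^ l.length * ∑ y, F V y) := by gcongr
      _ = (1 + Real.exp (-a * τ ^ 2)) ^ l.length * (2 * ∑ y, F V y) := by ring
      _ ≤ (1 + Real.exp (-a * τ ^ 2)) ^ l.length *
          ((1 + Real.exp (-a * τ ^ 2)) * ∑ y, F (V ⊔ Submodule.span ℝ {c j}) y) := by gcongr
      _ = _ := by ring

/-- Few sign combinations of the vectors `c j` are close to a translate of `U` if there is a long
chain. -/
theorem card_dist_le_of_isSpreadOut (c : ι → E) (w : E) (U : Submodule ℝ E) {τ : ℝ} (hτ : 0 < τ)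
    (R : ℝ) (l : List ι) (hl : IsSpreadOut c τ U l) :
    ((Finset.univ.filter fun y : ι → Bool ↦
        ‖Uᗮ.starProjection (∑ j, sgn (y j) • c j + w)‖ ^ 2 ≤ R * τ ^ 2).card : ℝ) ≤
      2 ^ Fintype.card ι * (3 / 4) ^ l.length * 2 ^ R := by
  -- This makes `exp (-a * τ ^ 2) = 1 / 2`, a gain of 3/4 per chain vector, while each counted `y`
  -- contributes at least `2 ^ (-R)` to the sum.
  set a := Real.log 2 / τ ^ 2 with ha
  have hlog : 0 < Real.log 2 := Real.log_pos (by norm_num)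
  have ha0 : 0 < a := by positivity
  have h1 := sum_exp_neg_dist_le c w U ha0.le hτ l hl
  have haτ : Real.exp (-a * τ ^ 2) = 1 / 2 := by
    rw [ha, neg_mul, div_mul_cancel₀ _ (by positivity), Real.exp_neg, Real.exp_log (by norm_num)]
    norm_num
  rw [haτ] at h1
  have h2 : ∑ y : ι → Bool, Real.exp (-a * ‖(chainSpan c U l)ᗮ.starProjection
      (∑ j, sgn (y j) • c j + w)‖ ^ 2) ≤ 2 ^ Fintype.card ι := by
    refine (Finset.sum_le_card_nsmul _ _ 1 fun y _ ↦ ?_).trans ?_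
    · rw [Real.exp_le_one_iff]
      have : 0 ≤ ‖(chainSpan c U l)ᗮ.starProjection (∑ j, sgn (y j) • c j + w)‖ ^ 2 := by positivity
      nlinarith
    · simp
  set S := Finset.univ.filter fun y : ι → Bool ↦
        ‖Uᗮ.starProjection (∑ j, sgn (y j) • c j + w)‖ ^ 2 ≤ R * τ ^ 2
  have h3 : (S.card : ℝ) * 2 ^ (-R) ≤ ∑ y : ι → Bool,
        Real.exp (-a * ‖Uᗮ.starProjection (∑ j, sgn (y j) • c j + w)‖ ^ 2) := by
    calc (S.card : ℝ) * 2 ^ (-R) = ∑ y ∈ S, (2 : ℝ) ^ (-R) := by simp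
      _ ≤ ∑ y ∈ S, Real.exp (-a * ‖Uᗮ.starProjection (∑ j, sgn (y j) • c j + w)‖ ^ 2) := by
        refine Finset.sum_le_sum fun y hy ↦ ?_
        rw [Real.rpow_def_of_pos (by norm_num)]
        apply Real.exp_le_exp.2
        have hy' := (Finset.mem_filter.1 hy).2
        have : a * ‖Uᗮ.starProjection (∑ j, sgn (y j) • c j + w)‖ ^ 2 ≤ a * (R * τ ^ 2) := by
          gcongr
        have h5 : a * (R * τ ^ 2) = Real.log 2 * R := by rw [ha]; field_simp
        linarith
      _ ≤ _ := Finset.sum_le_sum_of_subset_of_nonneg (Finset.subset_univ _)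
        fun _ _ _ ↦ (Real.exp_pos _).le
  have h4 : (2 : ℝ) ^ l.length * ((S.card : ℝ) * 2 ^ (-R)) ≤
      (1 + 1 / 2) ^ l.length * 2 ^ Fintype.card ι := by
    refine (mul_le_mul_of_nonneg_left h3 (by positivity)).trans (h1.trans ?_)
    gcongr
  have h5 : (3 / 4 : ℝ) ^ l.length = (1 + 1 / 2) ^ l.length / 2 ^ l.length := by
    rw [← div_pow]; norm_num
  have h6 : (2 : ℝ) ^ (-R) = (2 ^ R)⁻¹ := Real.rpow_neg (by norm_num) _
  have h7 : (0 : ℝ) < 2 ^ R := by positivity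
  have h8 : (0 : ℝ) < 2 ^ l.length := by positivity
  rw [h6] at h4
  rw [h5]
  have : (S.card : ℝ) = (2 ^ l.length * (S.card * (2 ^ R)⁻¹)) / 2 ^ l.length * 2 ^ R := by
    field_simp
  rw [this]
  calc _ ≤ ((1 + 1 / 2 : ℝ) ^ l.length * 2 ^ Fintype.card ι) / 2 ^ l.length * 2 ^ R := by gcongr
    _ = _ := by ring

end Geometry

/-! ### Sign vectors near a subspace, and counting tuples -/

section SignMatrices

/-- The `±1` vector of a bit string. -/
noncomputable def signVec {m : ℕ} (x : BitString m) : EuclideanSpace ℝ (Fin m) :=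
  WithLp.toLp 2 fun i ↦ sgn (x i)

theorem signVec_apply {m : ℕ} (x : BitString m) (i : Fin m) : signVec x i = sgn (x i) := rfl

theorem signVec_eq_sum {m : ℕ} (x : BitString m) :
    signVec x = ∑ j, sgn (x j) • EuclideanSpace.basisFun (Fin m) ℝ j := by
  ext i
  simp [signVec_apply, Pi.single_apply]

/-- Both sides are the trace of the projection. -/
theorem sum_norm_sq_starProjection {E ι : Type*} [NormedAddCommGroup E] [InnerProductSpace ℝ E]
    [FiniteDimensional ℝ E] [Fintype ι] (b : OrthonormalBasis ι ℝ E) (U : Submodule ℝ E) :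
    ∑ j, ‖U.starProjection (b j)‖ ^ 2 = Module.finrank ℝ U := by
  have hproj : LinearMap.IsProj U (U.starProjection : E →ₗ[ℝ] E) :=
    ⟨fun x ↦ U.starProjection_apply_mem x, fun x hx ↦ Submodule.starProjection_eq_self_iff.2 hx⟩
  have h := hproj.trace
  rw [LinearMap.trace_eq_sum_inner _ b] at h
  rw [← h]
  refine Finset.sum_congr rfl fun j _ ↦ ?_
  have h1 : U.starProjection (U.starProjection (b j)) = U.starProjection (b j) :=
    Submodule.starProjection_eq_self_iff.2 (U.starProjection_apply_mem _)
  rw [← real_inner_self_eq_norm_sq, Submodule.inner_starProjection_left_eq_right, h1]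
  rfl

/-- Few sign vectors are close to a subspace of at most half the dimension. -/
theorem card_signVec_near_le {m k : ℕ} (hm : m = 4 * k)
    (U : Submodule ℝ (EuclideanSpace ℝ (Fin m))) (hU : Module.finrank ℝ U ≤ 2 * k) :
    ((Finset.univ.filter fun x : BitString m ↦
        ‖Uᗮ.starProjection (signVec x)‖ ^ 2 ≤ (k : ℝ) / 16).card : ℝ) ≤
      2 ^ m * ((3 / 4) ^ k * 2 ^ ((k : ℝ) / 4)) := by
  set e := EuclideanSpace.basisFun (Fin m) ℝ with he
  rcases exists_isSpreadOut_or e (1 / 2) U k with ⟨l, hl, hc⟩ | ⟨l, hl, hc⟩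
  · have h := card_dist_le_of_isSpreadOut e 0 U (by norm_num) ((k : ℝ) / 4) l hc
    rw [hl, Fintype.card_fin] at h
    rw [← mul_assoc]
    convert h using 6 with x
    · rw [add_zero, signVec_eq_sum]
    · ring
  -- The greedy chain cannot stop early: `V` has dimension below `3 * k`, so the squared distances
  -- of the `4 * k` basis vectors from it sum to more than `k`, and they cannot all be at most 1/4.
  · exfalso
    set V := chainSpan e U l with hV
    have h1 : Module.finrank ℝ V < 3 * k :=
      (finrank_chainSpan_le e U l).trans_lt (by omega)
    have h2 : ∑ j, ‖Vᗮ.starProjection (e j)‖ ^ 2 = 4 * k - Module.finrank ℝ V := by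
      rw [← sum_norm_sq_starProjection e V, eq_sub_iff_add_eq, ← Finset.sum_add_distrib]
      have : ∀ j, ‖Vᗮ.starProjection (e j)‖ ^ 2 + ‖V.starProjection (e j)‖ ^ 2 = 1 := by
        intro j
        rw [add_comm, ← Submodule.norm_sq_eq_add_norm_sq_starProjection, e.orthonormal.1 j, one_pow]
      rw [Finset.sum_congr rfl fun j _ ↦ this j]
      simp [hm]
    have h3 : ∑ j, ‖Vᗮ.starProjection (e j)‖ ^ 2 ≤ ∑ _j : Fin m, (1 / 4 : ℝ) := by
      refine Finset.sum_le_sum fun j _ ↦ ?_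
      have := (hc j).le
      calc _ ≤ (1 / 2 : ℝ) ^ 2 := by gcongr
        _ = 1 / 4 := by norm_num
    have h4 : (Module.finrank ℝ V : ℝ) < 3 * k := by exact_mod_cast h1
    simp only [Finset.sum_const, Finset.card_univ, Fintype.card_fin, nsmul_eq_mul, hm] at h3
    push_cast at h3
    linarith

/-- The entries in `J` are free; once they are fixed, `S C` is a fixed set to which all other
entries are confined. Below, the entries are columns and `S C` consists of the vectors near a span
that involves only the columns in `J`. -/
theorem card_pi_le {α β : Type*} [Fintype α] [DecidableEq α] [Fintype β] [DecidableEq β]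
    (J : Finset α) (S : (α → β) → Finset β) {s : ℝ} (hs : 0 ≤ s) (hS : ∀ C, ((S C).card : ℝ) ≤ s)
    (hdep : ∀ C C' : α → β, (∀ j ∈ J, C j = C' j) → S C = S C') :
    ((Finset.univ.filter fun C : α → β ↦ ∀ j ∉ J, C j ∈ S C).card : ℝ) ≤
      (Fintype.card β : ℝ) ^ J.card * s ^ (Fintype.card α - J.card) := by
  set F := Finset.univ.filter fun C : α → β ↦ ∀ j ∉ J, C j ∈ S C with hF
  have hfib : ∀ d ∈ (Finset.univ : Finset (J → β)),
      ((F.filter fun C ↦ (fun j : J ↦ C j) = d).card : ℝ) ≤ s ^ (Fintype.card α - J.card) := by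
    intro d _
    rcases (F.filter fun C ↦ (fun j : J ↦ C j) = d).eq_empty_or_nonempty with h | ⟨C₀, hC₀⟩
    · rw [h]; simpa using pow_nonneg hs _
    · have hC₀' := (Finset.mem_filter.1 hC₀).2
      have hsub : (F.filter fun C ↦ (fun j : J ↦ C j) = d) ⊆
          Fintype.piFinset fun j ↦ if j ∈ J then {C₀ j} else S C₀ := by
        intro C hC
        obtain ⟨hC1, hC2⟩ := Finset.mem_filter.1 hC
        have hagree : ∀ j ∈ J, C j = C₀ j := fun j hj ↦
          congrFun (hC2.trans hC₀'.symm) ⟨j, hj⟩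
        rw [Fintype.mem_piFinset]
        intro j
        by_cases hj : j ∈ J
        · simp [hj, hagree j hj]
        · simp only [hj, if_false]
          rw [← hdep C C₀ hagree]
          exact (Finset.mem_filter.1 hC1).2 j hj
      have hcard : ((Fintype.piFinset fun j ↦ if j ∈ J then {C₀ j} else S C₀).card : ℝ) =
          ((S C₀).card : ℝ) ^ (Fintype.card α - J.card) := by
        rw [Fintype.card_piFinset]
        push_cast
        have : ∀ j, (((if j ∈ J then {C₀ j} else S C₀) : Finset β).card : ℝ) =
            if j ∈ J then 1 else ((S C₀).card : ℝ) := by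
          intro j; split_ifs <;> simp
        rw [Finset.prod_congr rfl fun j _ ↦ this j, Finset.prod_ite]
        simp only [Finset.prod_const_one, one_mul, Finset.prod_const]
        congr 1
        rw [← Finset.card_compl]
        congr 1
        ext j; simp
      calc _ ≤ ((Fintype.piFinset fun j ↦ if j ∈ J then {C₀ j} else S C₀).card : ℝ) := by
            exact_mod_cast Finset.card_le_card hsub
        _ = _ := hcard
        _ ≤ _ := by gcongr; exact hS C₀
  have h := Finset.card_eq_sum_card_fiberwise (s := F) (t := (Finset.univ : Finset (J → β)))
    (f := fun C (j : J) ↦ C j) (fun _ _ ↦ Finset.mem_coe.2 (Finset.mem_univ _))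
  rw [h]
  push_cast
  refine (Finset.sum_le_card_nsmul _ _ _ hfib).trans_eq ?_
  simp

end SignMatrices

/-! ### Matrices with rows in a dense set and robustly independent columns -/

section SpreadOutColumns

variable {m : ℕ}

/-- The span of the standard basis vectors with indices in `T`. -/
noncomputable def coordSpan (T : Finset (Fin m)) : Submodule ℝ (EuclideanSpace ℝ (Fin m)) :=
  Submodule.span ℝ (T.image (EuclideanSpace.basisFun (Fin m) ℝ) : Set _)

theorem finrank_coordSpan_le (T : Finset (Fin m)) :
    Module.finrank ℝ (coordSpan T) ≤ T.card :=
  (finrank_span_finset_le_card _).trans Finset.card_image_le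

/-- The number of matrices with columns `C` such that all columns are close to the span of few
columns and few standard basis vectors. -/
theorem card_columns_near_le {k : ℕ} (hm : m = 4 * k) (T J : Finset (Fin m)) (hT : T.card ≤ k)
    (hJ : J.card ≤ k) :
    ((Finset.univ.filter fun C : Fin m → BitString m ↦ ∀ j,
        ‖(coordSpan T ⊔ Submodule.span ℝ ((fun j ↦ signVec (C j)) '' (J : Set (Fin m))))ᗮ.starProjection
          (signVec (C j))‖ ^ 2 ≤ (k : ℝ) / 16).card : ℝ) ≤
      2 ^ (m * m) * ((3 / 4) ^ k * 2 ^ ((k : ℝ) / 4)) ^ (3 * k) := by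
  set g : ℝ := (3 / 4) ^ k * 2 ^ ((k : ℝ) / 4) with hg
  have hg0 : 0 < g := by positivity
  -- Needed at the end, where the exponent `m - J.card` is lowered to `3 * k`.
  have hg1 : g ≤ 1 := by
    have h2 : (2 : ℝ) ^ ((k : ℝ) / 4) = (2 ^ ((1 : ℝ) / 4)) ^ k := by
      rw [← Real.rpow_natCast, ← Real.rpow_mul (by norm_num)]; congr 1; ring
    have h3 : (2 : ℝ) ^ ((1 : ℝ) / 4) ≤ 4 / 3 := by
      have h4 : ((2 : ℝ) ^ ((1 : ℝ) / 4)) ^ 4 = 2 := by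
        rw [← Real.rpow_natCast, ← Real.rpow_mul (by norm_num)]; norm_num
      by_contra! h5
      have := pow_lt_pow_left₀ h5 (by norm_num) four_ne_zero
      rw [h4] at this
      norm_num at this
    rw [hg, h2, ← mul_pow]
    exact pow_le_one₀ (by positivity) (by linarith)
  let S : (Fin m → BitString m) → Finset (BitString m) := fun C ↦
    Finset.univ.filter fun x ↦ ‖(coordSpan T ⊔ Submodule.span ℝ
      ((fun j ↦ signVec (C j)) '' (J : Set (Fin m))))ᗮ.starProjection (signVec x)‖ ^ 2 ≤ (k : ℝ) / 16
  have hS : ∀ C, ((S C).card : ℝ) ≤ 2 ^ m * g := by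
    intro C
    refine card_signVec_near_le hm _ ?_
    refine (Submodule.finrank_add_le_finrank_add_finrank _ _).trans ?_
    have h1 := finrank_coordSpan_le T
    have h2 : Module.finrank ℝ (Submodule.span ℝ
        ((fun j ↦ signVec (C j)) '' (J : Set (Fin m)))) ≤ J.card := by
      classical
      rw [← Finset.coe_image]
      exact (finrank_span_finset_le_card _).trans Finset.card_image_le
    omega
  have hdep : ∀ C C' : Fin m → BitString m, (∀ j ∈ J, C j = C' j) → S C = S C' := by
    intro C C' h
    have : (fun j ↦ signVec (C j)) '' (J : Set (Fin m)) = (fun j ↦ signVec (C' j)) '' J := by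
      refine Set.image_congr fun j hj ↦ ?_
      rw [h j hj]
    simp only [S, this]
  have h := card_pi_le J S (by positivity) hS hdep
  have hsub : (Finset.univ.filter fun C : Fin m → BitString m ↦ ∀ j,
        ‖(coordSpan T ⊔ Submodule.span ℝ ((fun j ↦ signVec (C j)) '' (J : Set (Fin m))))ᗮ.starProjection
          (signVec (C j))‖ ^ 2 ≤ (k : ℝ) / 16) ⊆
      Finset.univ.filter fun C ↦ ∀ j ∉ J, C j ∈ S C := by
    intro C hC
    have hC' := (Finset.mem_filter.1 hC).2
    refine Finset.mem_filter.2 ⟨Finset.mem_univ _, fun j _ ↦ ?_⟩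
    exact Finset.mem_filter.2 ⟨Finset.mem_univ _, hC' j⟩
  refine le_trans (Nat.cast_le.2 ((Finset.card_le_card hsub).trans_eq ?_)) (h.trans ?_)
  · congr!
  simp only [Fintype.card_pi, Fintype.card_bool, Finset.prod_const, Finset.card_univ,
    Fintype.card_fin]
  push_cast
  rw [mul_pow, ← mul_assoc, ← pow_mul, ← pow_mul, ← pow_add]
  have h5 : m * J.card + m * (m - J.card) = m * m := by
    rw [← mul_add]; congr 1; omega
  rw [h5]
  have : g ^ (m - J.card) ≤ g ^ (3 * k) := pow_le_pow_of_le_one hg0.le hg1 (by omega)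
  gcongr

/-- A dense set of bit strings contains the rows of a square matrix whose columns are robustly
linearly independent. -/
theorem exists_rows_isSpreadOut {k : ℕ} (hm : m = 4 * k) (hk : 100 ≤ k) (A : Finset (BitString m))
    (hA : (2 : ℝ) ^ m ≤ A.card * (2 * 2 ^ ((k : ℝ) / 16))) :
    ∃ X : Fin m → BitString m, (∀ i, X i ∈ A) ∧ ∀ T : Finset (Fin m), T.card ≤ k →
      ∃ l : List (Fin m), l.length = k ∧
        IsSpreadOut (fun j ↦ signVec fun i ↦ X i j) (√(k : ℝ) / 4) (coordSpan T) l := by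
  by_contra! hcon
  set g : ℝ := (3 / 4) ^ k * 2 ^ ((k : ℝ) / 4) with hg
  let N : Finset (Fin m) → Finset (Fin m) → Finset (Fin m → BitString m) := fun T J ↦
    Finset.univ.filter fun C : Fin m → BitString m ↦ ∀ j,
        ‖(coordSpan T ⊔ Submodule.span ℝ ((fun j ↦ signVec (C j)) '' (J : Set (Fin m))))ᗮ.starProjection
          (signVec (C j))‖ ^ 2 ≤ (k : ℝ) / 16
  let P : Finset (Finset (Fin m) × Finset (Fin m)) :=
    Finset.univ.filter fun p ↦ p.1.card ≤ k ∧ p.2.card ≤ k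
  -- `X` lists rows, which lie in `A`; `Equiv.piComm` transposes to columns. Where no long chain
  -- exists, the greedy choice stops with fewer than `k` columns `J` such that all columns are near
  -- their span together with `coordSpan T`.
  have hsub : (Fintype.piFinset fun _ : Fin m ↦ A).map
      (Equiv.piComm fun _ _ : Fin m ↦ Bool).toEmbedding ⊆ P.biUnion fun p ↦ N p.1 p.2 := by
    intro C hC
    obtain ⟨X, hX, rfl⟩ := Finset.mem_map.1 hC
    obtain ⟨T, hT, hl⟩ := hcon X (Fintype.mem_piFinset.1 hX)
    rcases exists_isSpreadOut_or (fun j ↦ signVec fun i ↦ X i j) (√(k : ℝ) / 4) (coordSpan T) k with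
      ⟨l, h1, h2⟩ | ⟨l, h1, h2⟩
    · exact absurd h2 (hl l h1)
    · refine Finset.mem_biUnion.2 ⟨(T, l.toFinset), Finset.mem_filter.2
        ⟨Finset.mem_univ _, hT, (List.toFinset_card_le l).trans h1.le⟩,
        Finset.mem_filter.2 ⟨Finset.mem_univ _, fun j ↦ ?_⟩⟩
      have h3 := h2 j
      simp only [chainSpan_eq] at h3
      have h4 : ((l.toFinset : Finset (Fin m)) : Set (Fin m)) = {j | j ∈ l} := by
        ext; simp
      simp only [h4]
      refine (pow_le_pow_left₀ (norm_nonneg _) h3.le 2).trans_eq ?_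
      rw [div_pow, Real.sq_sqrt (by positivity)]
      norm_num
  have hcard := Finset.card_le_card hsub
  rw [Finset.card_map, Fintype.card_piFinset] at hcard
  simp only [Finset.prod_const, Finset.card_univ, Fintype.card_fin] at hcard
  have hbound : ((A.card : ℝ)) ^ m ≤ (2 ^ m * 2 ^ m) * (2 ^ (m * m) * g ^ (3 * k)) := by
    calc ((A.card : ℝ)) ^ m ≤ ((P.biUnion fun p ↦ N p.1 p.2).card : ℝ) := by exact_mod_cast hcard
      _ ≤ ((∑ p ∈ P, (N p.1 p.2).card : ℕ) : ℝ) := by exact_mod_cast Finset.card_biUnion_le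
      _ = ∑ p ∈ P, ((N p.1 p.2).card : ℝ) := by push_cast; rfl
      _ ≤ ∑ p ∈ P, (2 ^ (m * m) * g ^ (3 * k)) := by
        refine Finset.sum_le_sum fun p hp ↦ ?_
        obtain ⟨hp1, hp2⟩ := (Finset.mem_filter.1 hp).2
        exact card_columns_near_le hm p.1 p.2 hp1 hp2
      _ = P.card * (2 ^ (m * m) * g ^ (3 * k)) := by simp
      _ ≤ _ := by
        have : P.card ≤ 2 ^ m * 2 ^ m := by
          refine (Finset.card_le_univ _).trans_eq ?_
          simp
        have : (P.card : ℝ) ≤ 2 ^ m * 2 ^ m := by exact_mod_cast this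
        gcongr
  have hA' : ((2 : ℝ) ^ m) ^ m ≤ (2 ^ m * 2 ^ m) * (2 ^ (m * m) * g ^ (3 * k)) *
      (2 * 2 ^ ((k : ℝ) / 16)) ^ m := by
    refine (pow_le_pow_left₀ (by positivity) hA m).trans ?_
    rw [mul_pow]
    gcongr
  -- The density loss of `A` and the small-ball loss together cost only `2 ^ (k * k)`, against a
  -- gain of `(27 / 64) ^ (k * k)`. The choices of `T` and `J` and the factor 2 in `hA` cost `2 ^
  -- (12 * k)`, negligible for `k ≥ 100`.
  have e1 : ((2 : ℝ) ^ ((k : ℝ) / 16)) ^ m * (2 ^ ((k : ℝ) / 4)) ^ (3 * k) = 2 ^ (k * k) := by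
    rw [← Real.rpow_natCast, ← Real.rpow_natCast, ← Real.rpow_natCast, ← Real.rpow_mul (by norm_num),
      ← Real.rpow_mul (by norm_num), ← Real.rpow_add (by norm_num), hm]
    congr 1
    push_cast
    ring
  have e2 : (2 ^ m * 2 ^ m) * (2 ^ (m * m) * g ^ (3 * k)) * (2 * 2 ^ ((k : ℝ) / 16)) ^ m =
      2 ^ (m * m) * ((27 / 32) ^ k * 2 ^ 12) ^ k := by
    calc _ = 2 ^ (m * m) * (2 ^ m * 2 ^ m * 2 ^ m * ((3 / 4) ^ k) ^ (3 * k)) *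
          (((2 : ℝ) ^ ((k : ℝ) / 16)) ^ m * (2 ^ ((k : ℝ) / 4)) ^ (3 * k)) := by
          rw [hg, mul_pow, mul_pow]; ring
      _ = 2 ^ (m * m) * ((27 / 64) ^ (k * k) * 2 ^ (k * k) * 2 ^ (12 * k)) := by
          have h27 : ((3 / 4 : ℝ) ^ k) ^ (3 * k) = (27 / 64) ^ (k * k) := by
            rw [← pow_mul, show k * (3 * k) = 3 * (k * k) by ring, pow_mul]
            norm_num
          have h12 : (2 : ℝ) ^ m * 2 ^ m * 2 ^ m = 2 ^ (12 * k) := by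
            rw [← pow_add, ← pow_add, hm]; congr 1; ring
          rw [e1, h27, h12]
          ring
      _ = _ := by
          rw [← mul_pow, mul_pow _ _ k, ← pow_mul, ← pow_mul]
          norm_num
  have hlt : ((27 / 32 : ℝ) ^ k * 2 ^ 12) ^ k < 1 := by
    refine pow_lt_one₀ (by positivity) ?_ (by omega)
    have : (27 / 32 : ℝ) ^ k ≤ (27 / 32) ^ 100 := pow_le_pow_of_le_one (by norm_num) (by norm_num) hk
    have h2 : (27 / 32 : ℝ) ^ 100 * 2 ^ 12 < 1 := by norm_num
    linarith
  rw [e2, ← pow_mul] at hA'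
  have : (0 : ℝ) < 2 ^ (m * m) := by positivity
  nlinarith

end SpreadOutColumns

/-! ### Anti-concentration of the inner product on large rectangles -/

section Corruption

/-- The inner product of the sign vectors of two bit strings. -/
noncomputable def signInner {n : ℕ} (x y : BitString n) : ℝ := ∑ j, sgn (x j) * sgn (y j)

theorem card_le_two_mul_card_filter_le {α : Type*} (S : Finset α) (f : α → ℝ) (hf : ∀ x ∈ S, 0 ≤ f x)
    {t : ℝ} (ht : 0 < t) (h : ∑ x ∈ S, f x ≤ t * S.card / 2) :
    (S.card : ℝ) ≤ 2 * (S.filter fun x ↦ f x ≤ t).card := by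
  have h1 := Finset.card_filter_add_card_filter_not (s := S) (fun x ↦ f x ≤ t)
  have h2 : ((S.filter fun x ↦ ¬ f x ≤ t).card : ℝ) * t ≤ ∑ x ∈ S, f x := by
    rw [← nsmul_eq_mul]
    refine (Finset.card_nsmul_le_sum _ f t fun x hx ↦ ?_).trans
      (Finset.sum_le_sum_of_subset_of_nonneg (Finset.filter_subset _ _) fun x hx _ ↦ hf x hx)
    exact (not_le.1 (Finset.mem_filter.1 hx).2).le
  have h3 : ((S.filter fun x ↦ f x ≤ t).card : ℝ) + (S.filter fun x ↦ ¬ f x ≤ t).card = S.card := by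
    exact_mod_cast h1
  have h4 : ((S.filter fun x ↦ ¬ f x ≤ t).card : ℝ) ≤ S.card / 2 := by
    refine le_of_mul_le_mul_right ?_ ht
    linarith
  linarith

/-- Markov's inequality for `(1 / 64) ^ T.card`. The base 64 keeps both factors small exponentials
when `r = m / 512`. -/
theorem card_small_subsets_le (m : ℕ) (r : ℝ) :
    ((Finset.univ.filter fun T : Finset (Fin m) ↦ (T.card : ℝ) ≤ r).card : ℝ) ≤
      64 ^ r * (65 / 64) ^ m := by
  have h1 : ∑ T : Finset (Fin m), (1 / 64 : ℝ) ^ T.card = (65 / 64) ^ m := by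
    have := Fintype.sum_pow_mul_eq_add_pow (Fin m) (1 / 64 : ℝ) 1
    simp only [one_pow, mul_one, Fintype.card_fin] at this
    rw [this]; norm_num
  rw [← h1]
  have h2 : ((Finset.univ.filter fun T : Finset (Fin m) ↦ (T.card : ℝ) ≤ r).card : ℝ) * 64 ^ (-r) ≤
      ∑ T : Finset (Fin m), (1 / 64 : ℝ) ^ T.card := by
    rw [← nsmul_eq_mul]
    refine (Finset.card_nsmul_le_sum _ (fun T ↦ (1 / 64 : ℝ) ^ T.card) _ fun T hT ↦ ?_).trans
      (Finset.sum_le_sum_of_subset_of_nonneg (Finset.filter_subset _ _) fun T _ _ ↦ by positivity)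
    rw [one_div, inv_pow, ← Real.rpow_natCast, ← Real.rpow_neg (by norm_num)]
    exact Real.rpow_le_rpow_of_exponent_le (by norm_num)
      (neg_le_neg (Finset.mem_filter.1 hT).2)
  rw [Real.rpow_neg (by norm_num), ← div_eq_mul_inv, div_le_iff₀ (by positivity)] at h2
  linarith

variable {m k : ℕ}

/-- For rows that admit long chains of columns, few sign vectors have inner products close to `v`
with all rows outside of a small set. -/
theorem card_signInner_near_le (hm : m = 4 * k) (hk : 0 < k) (X : Fin m → BitString m)
    (T : Finset (Fin m)) (l : List (Fin m)) (hl : l.length = k)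
    (hc : IsSpreadOut (fun j ↦ signVec fun i ↦ X i j) (√(k : ℝ) / 4) (coordSpan T) l) (v : ℝ) :
    ((Finset.univ.filter fun y : BitString m ↦
        ∀ i ∉ T, |signInner (X i) y - v| ≤ √(k : ℝ) / 32).card : ℝ) ≤
      2 ^ m * (3 / 4) ^ k * 2 ^ ((k : ℝ) / 16) := by
  have hk' : (0 : ℝ) < k := by exact_mod_cast hk
  have hsq : √(k : ℝ) ^ 2 = k := Real.sq_sqrt hk'.le
  have h := card_dist_le_of_isSpreadOut (fun j ↦ signVec fun i ↦ X i j)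
    (WithLp.toLp 2 fun _ ↦ -v) (coordSpan T) (by positivity) ((k : ℝ) / 16) l hc
  rw [hl, Fintype.card_fin] at h
  refine le_trans (Nat.cast_le.2 (Finset.card_le_card fun y hy ↦ ?_)) h
  have hy' := (Finset.mem_filter.1 hy).2
  refine Finset.mem_filter.2 ⟨Finset.mem_univ _, ?_⟩
  -- `z` is `X y - v` as a signed sum of columns. Its coordinates in `T` lie in `coordSpan T`, so
  -- only the small ones count for the distance.
  set z := ∑ j, sgn (y j) • signVec (fun i ↦ X i j) + WithLp.toLp 2 fun _ ↦ -v with hz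
  have hzi : ∀ i, z i = signInner (X i) y - v := by
    intro i
    simp [hz, signVec_apply, signInner, mul_comm, sub_eq_add_neg]
  set u := ∑ i ∈ T, z i • EuclideanSpace.basisFun (Fin m) ℝ i with hu
  have hmem : u ∈ coordSpan T := by
    refine Submodule.sum_mem _ fun i hi ↦ Submodule.smul_mem _ _ (Submodule.subset_span ?_)
    exact Finset.mem_coe.2 (Finset.mem_image_of_mem _ hi)
  have hui : ∀ i, u i = if i ∈ T then z i else 0 := by
    intro i
    simp [hu, Pi.single_apply]
  have h1 : ‖z - u‖ ^ 2 ≤ m * ((k : ℝ) / 1024) := by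
    rw [EuclideanSpace.norm_sq_eq]
    refine (Finset.sum_le_card_nsmul _ _ ((k : ℝ) / 1024) fun i _ ↦ ?_).trans_eq (by simp)
    rw [PiLp.sub_apply, hui, Real.norm_eq_abs, sq_abs]
    by_cases hi : i ∈ T
    · rw [if_pos hi, sub_self, zero_pow two_ne_zero]; positivity
    · simp only [hi, if_false, sub_zero]
      rw [hzi, ← sq_abs]
      refine (pow_le_pow_left₀ (abs_nonneg _) (hy' i hi) 2).trans_eq ?_
      rw [div_pow, hsq]; norm_num
  calc _ ≤ ‖z - u‖ ^ 2 := by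
        gcongr
        exact norm_orthogonal_starProjection_le _ hmem z
    _ ≤ m * ((k : ℝ) / 1024) := h1
    _ = _ := by rw [div_pow, hsq, hm]; push_cast; ring

/-- On a large rectangle, the inner product is not concentrated near any value. -/
theorem card_signInner_far_ge (hm : m = 4 * k) (hk : 100 ≤ k) (A B : Finset (BitString m))
    (hA : (2 : ℝ) ^ m ≤ A.card * 2 ^ ((k : ℝ) / 16))
    (hB : (2 : ℝ) ^ m ≤ B.card * 2 ^ ((k : ℝ) / 16)) (v : ℝ) :
    (A.card : ℝ) * B.card / 2048 ≤
      ((A ×ˢ B).filter fun p ↦ √(k : ℝ) / 32 < |signInner p.1 p.2 - v|).card := by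
  classical
  by_contra! hcon
  have hk' : (100 : ℝ) ≤ k := by exact_mod_cast hk
  let far : BitString m → BitString m → Prop := fun x y ↦ √(k : ℝ) / 32 < |signInner x y - v|
  have hBpos : (0 : ℝ) < B.card := by
    by_contra! h0
    have : (B.card : ℝ) = 0 := le_antisymm h0 (by positivity)
    rw [this, zero_mul] at hB
    have : (0 : ℝ) < 2 ^ m := by positivity
    linarith
  have hD : ((A ×ˢ B).filter fun p ↦ √(k : ℝ) / 32 < |signInner p.1 p.2 - v|).card =
      ∑ x ∈ A, (B.filter (far x)).card := by
    rw [Finset.card_filter, Finset.sum_product]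
    simp only [Finset.card_filter, far]
  -- Two averaging steps: at least half of the `x` have few far partners, and for rows chosen among
  -- these, at least half of the `y` are far from at most `m / 512` rows.
  set A' := A.filter fun x ↦ ((B.filter (far x)).card : ℝ) ≤ B.card / 1024 with hA'
  have hA'card : (A.card : ℝ) ≤ 2 * A'.card := by
    refine card_le_two_mul_card_filter_le A (fun x ↦ ((B.filter (far x)).card : ℝ))
      (fun _ _ ↦ by positivity) (by positivity) ?_
    rw [hD] at hcon
    push_cast at hcon
    linarith
  obtain ⟨X, hXA, hX⟩ := exists_rows_isSpreadOut hm hk A' (by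
    refine hA.trans ?_
    have : (0 : ℝ) ≤ 2 ^ ((k : ℝ) / 16) := by positivity
    nlinarith)
  let bad : BitString m → Finset (Fin m) := fun y ↦ Finset.univ.filter fun i ↦ far (X i) y
  set B' := B.filter fun y ↦ ((bad y).card : ℝ) ≤ m / 512 with hB'
  have hmpos : (0 : ℝ) < m := by rw [hm]; push_cast; linarith
  have hB'card : (B.card : ℝ) ≤ 2 * B'.card := by
    refine card_le_two_mul_card_filter_le B (fun y ↦ ((bad y).card : ℝ))
      (fun _ _ ↦ by positivity) (by positivity) ?_
    have hswap : ∑ y ∈ B, ((bad y).card : ℝ) = ∑ i, ((B.filter (far (X i))).card : ℝ) := by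
      have : ∑ y ∈ B, (bad y).card = ∑ i, (B.filter (far (X i))).card := by
        simp only [bad, Finset.card_filter]
        exact Finset.sum_comm
      exact_mod_cast this
    rw [hswap]
    refine (Finset.sum_le_card_nsmul _ _ ((B.card : ℝ) / 1024) fun i _ ↦
      (Finset.mem_filter.1 (hXA i)).2).trans_eq ?_
    simp
    ring
  let 𝒯 := Finset.univ.filter fun T : Finset (Fin m) ↦ (T.card : ℝ) ≤ (m : ℝ) / 512
  have hcover : B' ⊆ 𝒯.biUnion fun T ↦ Finset.univ.filter fun y : BitString m ↦
        ∀ i ∉ T, |signInner (X i) y - v| ≤ √(k : ℝ) / 32 := by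
    intro y hy
    refine Finset.mem_biUnion.2 ⟨bad y, Finset.mem_filter.2 ⟨Finset.mem_univ _,
      (Finset.mem_filter.1 hy).2⟩, Finset.mem_filter.2 ⟨Finset.mem_univ _, fun i hi ↦ ?_⟩⟩
    by_contra! h
    exact hi (Finset.mem_filter.2 ⟨Finset.mem_univ _, h⟩)
  have hB'le : (B'.card : ℝ) ≤ (64 ^ ((m : ℝ) / 512) * (65 / 64) ^ m) *
      (2 ^ m * (3 / 4) ^ k * 2 ^ ((k : ℝ) / 16)) := by
    calc (B'.card : ℝ) ≤ ((𝒯.biUnion fun T ↦ Finset.univ.filter fun y : BitString m ↦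
        ∀ i ∉ T, |signInner (X i) y - v| ≤ √(k : ℝ) / 32).card : ℝ) := by
          exact_mod_cast Finset.card_le_card hcover
      _ ≤ ∑ T ∈ 𝒯, ((Finset.univ.filter fun y : BitString m ↦
        ∀ i ∉ T, |signInner (X i) y - v| ≤ √(k : ℝ) / 32).card : ℝ) := by
          exact_mod_cast Finset.card_biUnion_le
      _ ≤ ∑ T ∈ 𝒯, (2 ^ m * (3 / 4) ^ k * 2 ^ ((k : ℝ) / 16)) := by
          refine Finset.sum_le_sum fun T hT ↦ ?_
          have hT' : T.card ≤ k := by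
            have h1 := (Finset.mem_filter.1 hT).2
            have hm' : (m : ℝ) = 4 * k := by rw [hm]; push_cast; rfl
            have : (T.card : ℝ) ≤ k := by linarith
            exact_mod_cast this
          obtain ⟨l, hl, hc⟩ := hX T hT'
          convert card_signInner_near_le hm (by omega) X T l hl hc v
      _ = 𝒯.card * (2 ^ m * (3 / 4) ^ k * 2 ^ ((k : ℝ) / 16)) := by simp
      _ ≤ _ := by
          gcongr
          exact card_small_subsets_le m _
  have hfin : (2 : ℝ) ^ m ≤ 2 * ((64 ^ ((m : ℝ) / 512) * (65 / 64) ^ m) *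
      (2 ^ m * (3 / 4) ^ k * 2 ^ ((k : ℝ) / 16))) * 2 ^ ((k : ℝ) / 16) := by
    refine hB.trans ?_
    gcongr
    linarith
  have e64 : (64 : ℝ) ^ ((m : ℝ) / 512) = 2 ^ (3 * (k : ℝ) / 64) := by
    rw [show (64 : ℝ) = 2 ^ (6 : ℝ) by norm_num, ← Real.rpow_mul (by norm_num), hm]
    congr 1
    push_cast
    ring
  -- The exponents of 2 add up to `11 * k / 64 ≤ k / 4`. The final contradiction rests on `6 / 5 *
  -- (65 / 64) ^ 4 * (3 / 4) ≤ 24 / 25`.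
  have eexp : (64 : ℝ) ^ ((m : ℝ) / 512) * 2 ^ ((k : ℝ) / 16) * 2 ^ ((k : ℝ) / 16) ≤ (6 / 5) ^ k := by
    have h4 : (2 : ℝ) ^ ((1 : ℝ) / 4) ≤ 6 / 5 := by
      have h4 : ((2 : ℝ) ^ ((1 : ℝ) / 4)) ^ 4 = 2 := by
        rw [← Real.rpow_natCast, ← Real.rpow_mul (by norm_num)]; norm_num
      by_contra! h5
      have := pow_lt_pow_left₀ h5 (by norm_num) four_ne_zero
      rw [h4] at this
      norm_num at this
    rw [e64, ← Real.rpow_add (by norm_num), ← Real.rpow_add (by norm_num)]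
    calc (2 : ℝ) ^ (3 * (k : ℝ) / 64 + (k : ℝ) / 16 + (k : ℝ) / 16) ≤ 2 ^ (1 / 4 * (k : ℝ)) :=
          Real.rpow_le_rpow_of_exponent_le (by norm_num) (by linarith)
      _ = (2 ^ ((1 : ℝ) / 4)) ^ k := by rw [Real.rpow_mul (by norm_num), Real.rpow_natCast]
      _ ≤ _ := by gcongr
  have hlast : (2 : ℝ) ^ m ≤ 2 ^ m * (2 * (24 / 25) ^ k) := by
    calc (2 : ℝ) ^ m ≤ _ := hfin
      _ = 2 ^ m * (2 * ((64 ^ ((m : ℝ) / 512) * 2 ^ ((k : ℝ) / 16) * 2 ^ ((k : ℝ) / 16)) *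
          ((65 / 64) ^ m * (3 / 4) ^ k))) := by ring
      _ ≤ 2 ^ m * (2 * ((6 / 5) ^ k * ((65 / 64) ^ m * (3 / 4) ^ k))) := by gcongr
      _ = 2 ^ m * (2 * (6 / 5 * (65 / 64) ^ 4 * (3 / 4)) ^ k) := by
          rw [hm, pow_mul (65 / 64 : ℝ), mul_pow, mul_pow]; ring
      _ ≤ _ := by gcongr; norm_num
  have h24 : (24 / 25 : ℝ) ^ k ≤ (24 / 25) ^ 100 :=
    pow_le_pow_of_le_one (by norm_num) (by norm_num) hk
  have h25 : (24 / 25 : ℝ) ^ 100 < 1 / 2 := by norm_num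
  have : (0 : ℝ) < 2 ^ m := by positivity
  nlinarith

end Corruption

/-! ### From rectangles to transcripts -/

section Transcripts

/-- The fibres of `tr` are combinatorial rectangles. -/
def IsTranscript {α β Λ : Type*} (tr : α → β → Λ) : Prop :=
  ∀ x x' y y', tr x y = tr x' y' → tr x y' = tr x y

theorem IsTranscript.comp {α β α' β' Λ : Type*} {tr : α → β → Λ} (h : IsTranscript tr)
    (φ : α' → α) (ψ : β' → β) : IsTranscript fun x y ↦ tr (φ x) (ψ y) :=
  fun x x' y y' hxy ↦ h (φ x) (φ x') (ψ y) (ψ y') hxy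

theorem IsTranscript.pi {ι α β : Type*} {Λ : ι → Type*} {tr : ∀ i, α → β → Λ i}
    (h : ∀ i, IsTranscript (tr i)) : IsTranscript fun x y i ↦ tr i x y :=
  fun x x' y y' hxy ↦ funext fun i ↦ h i x x' y y' (congrFun hxy i)

/-- The inner product cannot be approximated from a short transcript. -/
theorem card_signInner_approx_ge {m k : ℕ} (hm : m = 4 * k) (hk : 100 ≤ k) {Λ : Type*} [Fintype Λ]
    (tr : BitString m → BitString m → Λ) (htr : IsTranscript tr) (h : Λ → ℝ)
    (hΛ : 2 * (Fintype.card Λ : ℝ) ≤ 2 ^ ((k : ℝ) / 16)) :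
    (4 : ℝ) ^ m / 4096 ≤ ((Finset.univ : Finset (BitString m × BitString m)).filter fun p ↦
      √(k : ℝ) / 32 < |signInner p.1 p.2 - h (tr p.1 p.2)|).card := by
  classical
  set err := (Finset.univ : Finset (BitString m × BitString m)).filter fun p ↦
      √(k : ℝ) / 32 < |signInner p.1 p.2 - h (tr p.1 p.2)| with herr
  set q : ℝ := 2 ^ ((k : ℝ) / 16) with hq
  have hq0 : 0 < q := by positivity
  let A : Λ → Finset (BitString m) := fun a ↦ Finset.univ.filter fun x ↦ ∃ y, tr x y = a
  let B : Λ → Finset (BitString m) := fun a ↦ Finset.univ.filter fun y ↦ ∃ x, tr x y = a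
  have hrect : ∀ a, (Finset.univ.filter fun p : BitString m × BitString m ↦ tr p.1 p.2 = a) =
      A a ×ˢ B a := by
    intro a
    ext ⟨x, y⟩
    simp only [Finset.mem_filter, Finset.mem_univ, true_and, Finset.mem_product, A, B]
    constructor
    · exact fun hxy ↦ ⟨⟨y, hxy⟩, ⟨x, hxy⟩⟩
    · rintro ⟨⟨y', hy'⟩, ⟨x', hx'⟩⟩
      exact (htr x x' y' y (hy'.trans hx'.symm)).trans hy'
  have hcube : ∀ S : Finset (BitString m), (S.card : ℝ) ≤ 2 ^ m := by
    intro S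
    have := Finset.card_le_univ S
    simp only [Fintype.card_pi, Fintype.card_bool, Finset.prod_const, Finset.card_univ,
      Fintype.card_fin] at this
    exact_mod_cast this
  have h2 : (0 : ℝ) < 2 ^ m := by positivity
  have h4 : (4 : ℝ) ^ m = 2 ^ m * 2 ^ m := by rw [← mul_pow]; norm_num
  -- A rectangle with at least `4 ^ m / q` points has both sides at least `2 ^ m / q`, so
  -- anti-concentration applies; for smaller ones the left side is not positive. The subtracted
  -- terms sum to at most half of all pairs.
  have hone : ∀ a, (((A a ×ˢ B a).card : ℝ) - 4 ^ m / q) / 2048 ≤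
      (err.filter fun p ↦ tr p.1 p.2 = a).card := by
    intro a
    rw [Finset.card_product]
    push_cast
    by_cases hbig : (4 : ℝ) ^ m ≤ (A a).card * (B a).card * q
    · have hA : (2 : ℝ) ^ m ≤ (A a).card * q := by
        have := hcube (B a)
        have hAq : 0 ≤ ((A a).card : ℝ) * q := by positivity
        refine le_of_mul_le_mul_right ?_ h2
        rw [← h4]
        nlinarith
      have hB : (2 : ℝ) ^ m ≤ (B a).card * q := by
        have := hcube (A a)
        have hBq : 0 ≤ ((B a).card : ℝ) * q := by positivity
        refine le_of_mul_le_mul_right ?_ h2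
        rw [← h4]
        nlinarith
      have hfar := card_signInner_far_ge hm hk (A a) (B a) hA hB (h a)
      have hle : ((A a ×ˢ B a).filter fun p ↦ √(k : ℝ) / 32 < |signInner p.1 p.2 - h a|).card ≤
          (err.filter fun p ↦ tr p.1 p.2 = a).card := by
        refine Finset.card_le_card fun p hp ↦ ?_
        obtain ⟨hp1, hp2⟩ := Finset.mem_filter.1 hp
        rw [← hrect] at hp1
        have hpa := (Finset.mem_filter.1 hp1).2
        refine Finset.mem_filter.2 ⟨Finset.mem_filter.2 ⟨Finset.mem_univ _, ?_⟩, hpa⟩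
        rw [hpa]
        exact hp2
      have hle' : (((A a ×ˢ B a).filter fun p ↦
          √(k : ℝ) / 32 < |signInner p.1 p.2 - h a|).card : ℝ) ≤
          (err.filter fun p ↦ tr p.1 p.2 = a).card := by exact_mod_cast hle
      have : 0 ≤ (4 : ℝ) ^ m / q := by positivity
      linarith
    · have h5 : ((A a).card : ℝ) * (B a).card ≤ 4 ^ m / q := by
        rw [le_div_iff₀ hq0]; exact (not_le.1 hbig).le
      have : (0 : ℝ) ≤ (err.filter fun p ↦ tr p.1 p.2 = a).card := by positivity
      linarith
  have hsum : ∑ a, (((A a ×ˢ B a).card : ℝ) - 4 ^ m / q) / 2048 ≤ err.card := by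
    refine (Finset.sum_le_sum fun a _ ↦ hone a).trans_eq ?_
    rw [Finset.card_eq_sum_card_fiberwise (s := err) (t := Finset.univ)
      (f := fun p ↦ tr p.1 p.2) (fun _ _ ↦ Finset.mem_coe.2 (Finset.mem_univ _))]
    push_cast
    rfl
  have htot : ∑ a, ((A a ×ˢ B a).card : ℝ) = 4 ^ m := by
    have := Finset.card_eq_sum_card_fiberwise
      (s := (Finset.univ : Finset (BitString m × BitString m))) (t := Finset.univ)
      (f := fun p ↦ tr p.1 p.2) (fun _ _ ↦ Finset.mem_coe.2 (Finset.mem_univ _))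
    simp only [hrect] at this
    have h6 : (Finset.univ : Finset (BitString m × BitString m)).card = 2 ^ m * 2 ^ m := by simp
    rw [h6] at this
    rw [h4]
    exact_mod_cast this.symm
  rw [← Finset.sum_div, Finset.sum_sub_distrib, htot] at hsum
  simp only [Finset.sum_const, Finset.card_univ, nsmul_eq_mul] at hsum
  have h7 : (Fintype.card Λ : ℝ) * (4 ^ m / q) ≤ 4 ^ m / 2 := by
    rw [mul_div_assoc', div_le_iff₀ hq0]
    have : (0 : ℝ) < 4 ^ m := by positivity
    nlinarith
  linarith

end Transcripts

/-! ### Masked samples and tail bounds for biased pairs -/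

section Sampling

theorem sum_prod_mul_comp {N : ℕ} {α γ : Type*} [Fintype α] [Fintype γ] [DecidableEq γ]
    (w : α → ℝ) (φ : α → γ) (G : (Fin N → γ) → ℝ) :
    ∑ ω : Fin N → α, (∏ j, w (ω j)) * G (fun j ↦ φ (ω j)) =
      ∑ z : Fin N → γ, (∏ j, ∑ a with φ a = z j, w a) * G z := by
  classical
  rw [← Finset.sum_fiberwise Finset.univ (fun (ω : Fin N → α) j ↦ φ (ω j))]
  refine Finset.sum_congr rfl fun z _ ↦ ?_
  have hfib : (Finset.univ.filter fun ω : Fin N → α ↦ (fun j ↦ φ (ω j)) = z) =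
      Fintype.piFinset fun j ↦ Finset.univ.filter fun a ↦ φ a = z j := by
    ext ω
    simp [funext_iff]
  rw [Finset.prod_univ_sum, Finset.sum_mul, ← hfib]
  refine Finset.sum_congr rfl fun ω hω ↦ ?_
  rw [(Finset.mem_filter.1 hω).2]

/-- Density on pairs of bit strings: the coordinatewise products of the signs are independent with
mean `s`, and the first string is uniform. -/
noncomputable def biasedWeight (s : ℝ) {N : ℕ} (p : BitString N × BitString N) : ℝ :=
  ∏ j, (1 + s * (sgn (p.1 j) * sgn (p.2 j))) / 4

/-- The masked sample of the string `u` that is selected by `ω`. -/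
def maskedSample {N : ℕ} {ι : Type*} (ω : Fin N → ι × Bool) (u : ι → Bool) : BitString N :=
  fun j ↦ xor (u (ω j).1) (ω j).2

/-- The common mask makes each sampled bit of `u` uniform and keeps the product of the two signs. So
the law of the sample depends on `u` and `v` only through their weighted correlation. -/
theorem sum_maskedSample {N : ℕ} {ι : Type*} [Fintype ι] (p : ι → ℝ) (hp : ∑ i, p i = 1)
    (u v : ι → Bool) (F : BitString N × BitString N → ℝ) :
    ∑ ω : Fin N → ι × Bool, (∏ j, p (ω j).1 / 2) * F (maskedSample ω u, maskedSample ω v) =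
      ∑ q, biasedWeight (∑ i, p i * (sgn (u i) * sgn (v i))) q * F q := by
  have h := sum_prod_mul_comp (N := N) (fun a : ι × Bool ↦ p a.1 / 2)
    (fun a ↦ (xor (u a.1) a.2, xor (v a.1) a.2)) (fun z ↦ F (fun j ↦ (z j).1, fun j ↦ (z j).2))
  refine h.trans ?_
  rw [← Equiv.sum_comp (Equiv.arrowProdEquivProdArrow (Fin N) (fun _ ↦ Bool) (fun _ ↦ Bool))]
  refine Finset.sum_congr rfl fun z _ ↦ ?_
  congr 1
  refine Finset.prod_congr rfl fun j _ ↦ ?_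
  change _ = (1 + (∑ i, p i * (sgn (u i) * sgn (v i))) * (sgn (z j).1 * sgn (z j).2)) / 4
  rw [Finset.sum_filter, Fintype.sum_prod_type, ← hp, Finset.sum_mul, ← Finset.sum_add_distrib,
    Finset.sum_div]
  refine Finset.sum_congr rfl fun i _ ↦ ?_
  rw [Fintype.sum_bool]
  rcases z j with ⟨a, b⟩
  cases u i <;> cases v i <;> cases a <;> cases b <;> simp [sgn] <;> ring

/-- The moment generating function of a sum of `N` independent signs with mean `s`. -/
theorem sum_biasedWeight_mul_exp {N : ℕ} (s t : ℝ) :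
    ∑ q : BitString N × BitString N, biasedWeight s q * Real.exp (t * signInner q.1 q.2) =
      (Real.cosh t + s * Real.sinh t) ^ N := by
  rw [← Equiv.sum_comp (Equiv.arrowProdEquivProdArrow (Fin N) (fun _ ↦ Bool) (fun _ ↦ Bool))]
  have h1 : Real.cosh t + s * Real.sinh t = ∑ a : Bool × Bool,
      (1 + s * (sgn a.1 * sgn a.2)) / 4 * Real.exp (t * (sgn a.1 * sgn a.2)) := by
    rw [Fintype.sum_prod_type, Fintype.sum_bool, Fintype.sum_bool, Fintype.sum_bool,
      Real.cosh_eq, Real.sinh_eq]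
    simp only [sgn, if_true, Bool.false_eq_true, if_false]
    norm_num
    ring
  rw [h1, Fintype.sum_pow]
  refine Finset.sum_congr rfl fun z _ ↦ ?_
  rw [Finset.prod_mul_distrib, ← Real.exp_sum, ← Finset.mul_sum]
  rfl

theorem biasedWeight_nonneg {s : ℝ} (hs : |s| ≤ 1) {N : ℕ} (q : BitString N × BitString N) :
    0 ≤ biasedWeight s q := by
  refine Finset.prod_nonneg fun j _ ↦ ?_
  have h1 : |s * (sgn (q.1 j) * sgn (q.2 j))| ≤ 1 := by
    rw [abs_mul, abs_mul, abs_sgn, abs_sgn]; simpa using hs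
  have := (abs_le.1 h1).1
  linarith

theorem biasedWeight_le {s : ℝ} (hs : |s| ≤ 1) {N : ℕ} (q : BitString N × BitString N) :
    biasedWeight s q ≤ Real.exp (s * signInner q.1 q.2) / 4 ^ N := by
  have h : Real.exp (s * signInner q.1 q.2) / 4 ^ N =
      ∏ j, Real.exp (s * (sgn (q.1 j) * sgn (q.2 j))) / 4 := by
    rw [Finset.prod_div_distrib, ← Real.exp_sum, ← Finset.mul_sum]
    simp [signInner]
  rw [h]
  refine Finset.prod_le_prod (fun j _ ↦ ?_) fun j _ ↦ ?_
  · have h1 : |s * (sgn (q.1 j) * sgn (q.2 j))| ≤ 1 := by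
      rw [abs_mul, abs_mul, abs_sgn, abs_sgn]; simpa using hs
    have := (abs_le.1 h1).1
    linarith
  · have := Real.add_one_le_exp (s * (sgn (q.1 j) * sgn (q.2 j)))
    linarith

theorem cosh_le_one_add_sq {t : ℝ} (ht : |t| ≤ 1) : Real.cosh t ≤ 1 + t ^ 2 := by
  have h1 := Real.cosh_le_exp_half_sq t
  have h2 : t ^ 2 ≤ 1 := (sq_le_one_iff_abs_le_one t).2 ht
  have h3 := Real.abs_exp_sub_one_le (x := t ^ 2 / 2)
    (by rw [abs_of_nonneg (by positivity)]; linarith)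
  rw [abs_of_nonneg (a := t ^ 2 / 2) (by positivity)] at h3
  have := (abs_le.1 h3).2
  linarith

theorem sum_biasedWeight_mul_exp_neg_le {N : ℕ} {s t : ℝ} (hs : 0 ≤ s) (hs1 : s ≤ 1) (ht : 0 ≤ t)
    (ht1 : t ≤ 1) :
    ∑ q : BitString N × BitString N, biasedWeight s q * Real.exp (-t * signInner q.1 q.2) ≤
      Real.exp (N * (t ^ 2 - s * t)) := by
  rw [sum_biasedWeight_mul_exp, Real.cosh_neg, Real.sinh_neg, Real.exp_nat_mul]
  have h1 := cosh_le_one_add_sq (abs_le.2 ⟨by linarith, ht1⟩ : |t| ≤ 1)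
  have h2 : t ≤ Real.sinh t := Real.self_le_sinh_iff.2 ht
  have h3 := Real.add_one_le_exp (t ^ 2 - s * t)
  have h4 : 0 ≤ Real.cosh t + s * -Real.sinh t := by
    have := Real.sinh_lt_cosh t
    have : 0 ≤ Real.sinh t := ht.trans h2
    nlinarith
  exact pow_le_pow_left₀ h4 (by nlinarith) N

theorem sum_biasedWeight_mul_exp_pos_le {N : ℕ} {s t : ℝ} (hs : 0 ≤ s) (ht : 0 ≤ t)
    (ht1 : t ≤ 1) :
    ∑ q : BitString N × BitString N, biasedWeight s q * Real.exp (t * signInner q.1 q.2) ≤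
      Real.exp (N * (t ^ 2 + 2 * s * t)) := by
  rw [sum_biasedWeight_mul_exp, Real.exp_nat_mul]
  have h1 := cosh_le_one_add_sq (abs_le.2 ⟨by linarith, ht1⟩ : |t| ≤ 1)
  have h0 : 0 ≤ Real.sinh t := Real.sinh_nonneg_iff.2 ht
  have h2 : Real.sinh t ≤ 2 * t := by
    have h5 := Real.abs_exp_sub_one_le (x := t) (by rwa [abs_of_nonneg ht])
    rw [abs_of_nonneg ht] at h5
    have h6 := (abs_le.1 h5).2
    have h7 := Real.add_one_le_exp (-t)
    rw [Real.sinh_eq]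
    linarith
  have h3 := Real.add_one_le_exp (t ^ 2 + 2 * s * t)
  have h4 : 0 ≤ Real.cosh t + s * Real.sinh t := by
    have := Real.cosh_pos t
    positivity
  exact pow_le_pow_left₀ h4 (by nlinarith) N

/-- Under the biased weight, the inner product is probably large, and a set that is small under the
uniform distribution is improbable. -/
theorem sum_biasedWeight_bad_le {N : ℕ} (hN : 0 < N) {s G K : ℝ} (hs : 0 ≤ s) (hs1 : s ≤ 1)
    (W : Finset (BitString N × BitString N)) :
    ∑ q with signInner q.1 q.2 < G * √(N : ℝ) ∨ q ∈ W, biasedWeight s q ≤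
      Real.exp (1 + G - s * √(N : ℝ)) + Real.exp (1 + 2 * (s * √(N : ℝ)) - K) +
        Real.exp (s * √(N : ℝ) * K) * (W.card / 4 ^ N) := by
  classical
  have hN1 : (1 : ℝ) ≤ N := by exact_mod_cast hN
  set r := √(N : ℝ) with hr
  have hr1 : 1 ≤ r := Real.one_le_sqrt.2 hN1
  have hrr : r * r = N := Real.mul_self_sqrt (by positivity)
  have hr0 : 0 < r := by linarith
  have hsabs : |s| ≤ 1 := abs_le.2 ⟨by linarith, hs1⟩
  have ht1 : 1 / r ≤ 1 := by rw [div_le_one hr0]; exact hr1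
  -- The three terms are Chernoff bounds with parameter `1 / r` for inner products below `G * r` and
  -- above `K * r`, and, for `q ∈ W` with inner product at most `r * K`, the density bound of
  -- `biasedWeight_le`.
  have hpt : ∀ q : BitString N × BitString N,
      (if signInner q.1 q.2 < G * r ∨ q ∈ W then biasedWeight s q else 0) ≤
      Real.exp G * (biasedWeight s q * Real.exp (-(1 / r) * signInner q.1 q.2)) +
      Real.exp (-K) * (biasedWeight s q * Real.exp (1 / r * signInner q.1 q.2)) +
      (if q ∈ W then Real.exp (s * r * K) / 4 ^ N else 0) := by
    intro q
    have hb := biasedWeight_nonneg hsabs q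
    have e1 : Real.exp G * (biasedWeight s q * Real.exp (-(1 / r) * signInner q.1 q.2)) =
        biasedWeight s q * Real.exp (G - signInner q.1 q.2 / r) := by
      rw [sub_eq_add_neg, Real.exp_add]
      rw [show -(1 / r) * signInner q.1 q.2 = -(signInner q.1 q.2 / r) by ring]
      ring
    have e2 : Real.exp (-K) * (biasedWeight s q * Real.exp (1 / r * signInner q.1 q.2)) =
        biasedWeight s q * Real.exp (signInner q.1 q.2 / r - K) := by
      rw [sub_eq_add_neg, Real.exp_add]
      rw [show 1 / r * signInner q.1 q.2 = signInner q.1 q.2 / r by ring]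
      ring
    rw [e1, e2]
    have p1 : 0 ≤ biasedWeight s q * Real.exp (G - signInner q.1 q.2 / r) := by positivity
    have p2 : 0 ≤ biasedWeight s q * Real.exp (signInner q.1 q.2 / r - K) := by positivity
    have p3 : 0 ≤ (if q ∈ W then Real.exp (s * r * K) / 4 ^ N else 0) := by
      split_ifs <;> positivity
    split_ifs with h h' h'
    · rcases le_or_gt (signInner q.1 q.2) (r * K) with hK | hK
      · have h5 := biasedWeight_le hsabs q
        have h6 : Real.exp (s * signInner q.1 q.2) / 4 ^ N ≤ Real.exp (s * r * K) / 4 ^ N := by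
          gcongr ?_ / _
          apply Real.exp_le_exp.2
          rw [mul_assoc]
          gcongr
        linarith
      · have h5 : 1 ≤ Real.exp (signInner q.1 q.2 / r - K) := by
          apply Real.one_le_exp
          rw [sub_nonneg, le_div_iff₀ hr0]
          linarith
        have : 0 ≤ Real.exp (s * r * K) / 4 ^ N := by positivity
        nlinarith
    · have h7 := h.resolve_right h'
      have h5 : 1 ≤ Real.exp (G - signInner q.1 q.2 / r) := by
        apply Real.one_le_exp
        rw [sub_nonneg, div_le_iff₀ hr0]
        exact h7.le
      nlinarith
    · have : 0 ≤ Real.exp (s * r * K) / 4 ^ N := by positivity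
      linarith
    · linarith
  rw [Finset.sum_filter]
  refine (Finset.sum_le_sum fun q _ ↦ hpt q).trans ?_
  rw [Finset.sum_add_distrib, Finset.sum_add_distrib, ← Finset.mul_sum, ← Finset.mul_sum,
    ← Finset.sum_filter]
  have m1 := sum_biasedWeight_mul_exp_neg_le (N := N) hs hs1 (by positivity) ht1
  have m2 := sum_biasedWeight_mul_exp_pos_le (N := N) hs (by positivity) ht1
  have x1 : (N : ℝ) * ((1 / r) ^ 2 - s * (1 / r)) = 1 - s * r := by
    rw [← hrr]; field_simp
  have x2 : (N : ℝ) * ((1 / r) ^ 2 + 2 * s * (1 / r)) = 1 + 2 * (s * r) := by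
    rw [← hrr]; field_simp
  rw [x1] at m1
  rw [x2] at m2
  gcongr ?_ + ?_ + ?_
  · calc _ ≤ Real.exp G * Real.exp (1 - s * r) := by gcongr
      _ = _ := by rw [← Real.exp_add]; congr 1; ring
  · calc _ ≤ Real.exp (-K) * Real.exp (1 + 2 * (s * r)) := by gcongr
      _ = _ := by rw [← Real.exp_add]; congr 1; ring
  · rw [Finset.filter_mem_eq_inter, Finset.univ_inter, Finset.sum_const, nsmul_eq_mul]
    apply le_of_eq
    ring

end Sampling

/-! ### Deciding thresholds of the inner product by gap-Hamming functions -/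

section Simulation

/-- The input pairs with a gap (in terms of the inner product) on which `f` gives the wrong
answer. -/
noncomputable def gapErrors (G : ℝ) {N : ℕ} (f : BitString N → BitString N → Bool) :
    Finset (BitString N × BitString N) :=
  Finset.univ.filter fun p ↦ (G * √(N : ℝ) ≤ signInner p.1 p.2 ∧ f p.1 p.2 = true) ∨
    (signInner p.1 p.2 ≤ -(G * √(N : ℝ)) ∧ f p.1 p.2 = false)

/-- The error probability of the simulation of a threshold by masked samples. -/
noncomputable def simError (G T H K ε : ℝ) : ℝ :=
  Real.exp (1 + G - T) + Real.exp (1 + 2 * H - K) + Real.exp (H * K) * ε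

variable {N : ℕ} {ι : Type*}

theorem maskedSample_not (ω : Fin N → ι × Bool) (v : ι → Bool) (j : Fin N) :
    maskedSample ω (fun i ↦ !v i) j = !maskedSample ω v j := by
  simp [maskedSample]

theorem signInner_not (x y : BitString N) : signInner x (fun j ↦ !y j) = -signInner x y := by
  simp [signInner, sgn_not]

variable [Fintype ι]

theorem sum_maskedSample_bad_le (hN : 0 < N) {p : ι → ℝ} (hp0 : ∀ i, 0 ≤ p i) (hp : ∑ i, p i = 1)
    (u v : ι → Bool) {G T H K ε : ℝ} (hT0 : 0 ≤ T) (hK : 0 ≤ K)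
    (W : Finset (BitString N × BitString N)) (hW : (W.card : ℝ) ≤ ε * 4 ^ N)
    (hT : T ≤ (∑ i, p i * (sgn (u i) * sgn (v i))) * √(N : ℝ))
    (hH : (∑ i, p i * (sgn (u i) * sgn (v i))) * √(N : ℝ) ≤ H) :
    ∑ ω : Fin N → ι × Bool, (∏ j, p (ω j).1 / 2) *
      (if signInner (maskedSample ω u) (maskedSample ω v) < G * √(N : ℝ) ∨
        (maskedSample ω u, maskedSample ω v) ∈ W then 1 else 0) ≤ simError G T H K ε := by
  classical
  set s := ∑ i, p i * (sgn (u i) * sgn (v i)) with hs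
  have hr0 : 0 < √(N : ℝ) := Real.sqrt_pos.2 (by exact_mod_cast hN)
  have hs0 : 0 ≤ s := by
    by_contra! h
    have := mul_neg_of_neg_of_pos h hr0
    linarith
  have hs1 : s ≤ 1 := by
    rw [← hp]
    refine Finset.sum_le_sum fun i _ ↦ ?_
    have : sgn (u i) * sgn (v i) ≤ 1 := by
      refine (le_abs_self _).trans ?_
      rw [abs_mul, abs_sgn, abs_sgn, one_mul]
    have := hp0 i
    nlinarith
  have h := sum_maskedSample (N := N) p hp u v fun q ↦
    if signInner q.1 q.2 < G * √(N : ℝ) ∨ q ∈ W then (1 : ℝ) else 0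
  rw [h]
  simp only [mul_ite, mul_one, mul_zero]
  rw [← Finset.sum_filter]
  refine (sum_biasedWeight_bad_le hN (G := G) (K := K) hs0 hs1 W).trans ?_
  have hW' : (W.card : ℝ) / 4 ^ N ≤ ε := by rwa [div_le_iff₀ (by positivity)]
  have hε : 0 ≤ ε := le_trans (by positivity) hW'
  unfold simError
  gcongr

/-- Masked samples decide the sign of the correlation with small error. -/
theorem sum_maskedSample_error_le (hN : 0 < N) {p : ι → ℝ} (hp0 : ∀ i, 0 ≤ p i)
    (hp : ∑ i, p i = 1) (u v : ι → Bool) {G T H K ε : ℝ} (hT0 : 0 < T) (hK : 0 ≤ K)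
    (f : BitString N → BitString N → Bool) (hf : ((gapErrors G f).card : ℝ) ≤ ε * 4 ^ N)
    (hT : T ≤ |∑ i, p i * (sgn (u i) * sgn (v i))| * √(N : ℝ))
    (hH : |∑ i, p i * (sgn (u i) * sgn (v i))| * √(N : ℝ) ≤ H) :
    ∑ ω : Fin N → ι × Bool, (∏ j, p (ω j).1 / 2) *
      (if (f (maskedSample ω u) (maskedSample ω v) = true ↔
        0 < ∑ i, p i * (sgn (u i) * sgn (v i))) then 1 else 0) ≤ simError G T H K ε := by
  classical
  set s := ∑ i, p i * (sgn (u i) * sgn (v i)) with hs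
  have hwt : ∀ ω : Fin N → ι × Bool, 0 ≤ ∏ j, p (ω j).1 / 2 := fun ω ↦
    Finset.prod_nonneg fun j _ ↦ div_nonneg (hp0 _) (by norm_num)
  rcases lt_trichotomy s 0 with h | h | h
  -- Complementing the second string reverses all correlations and so reduces this case to a
  -- positive one, with the error set transported by `e`.
  · rw [abs_of_neg h] at hT hH
    have hs' : ∑ i, p i * (sgn (u i) * sgn (!v i)) = -s := by
      simp [hs, sgn_not]
    let e : BitString N × BitString N ≃ BitString N × BitString N :=
      ⟨fun q ↦ (q.1, fun j ↦ !q.2 j), fun q ↦ (q.1, fun j ↦ !q.2 j), fun q ↦ by simp,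
        fun q ↦ by simp⟩
    have hW : (((gapErrors G f).map e.toEmbedding).card : ℝ) ≤ ε * 4 ^ N := by
      rwa [Finset.card_map]
    refine le_trans (Finset.sum_le_sum fun ω _ ↦ ?_) (sum_maskedSample_bad_le hN hp0 hp u
      (fun i ↦ !v i) (G := G) hT0.le hK _ hW (by rw [hs']; exact hT) (by rw [hs']; exact hH))
    refine mul_le_mul_of_nonneg_left ?_ (hwt ω)
    have hnot : maskedSample ω (fun i ↦ !v i) = fun j ↦ !maskedSample ω v j :=
      funext fun j ↦ maskedSample_not ω v j
    rw [hnot, signInner_not]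
    split_ifs with h1 h2 h2
    · exact le_rfl
    · exfalso
      push Not at h2
      obtain ⟨h2a, h2b⟩ := h2
      apply h2b
      refine Finset.mem_map.2 ⟨(maskedSample ω u, maskedSample ω v), ?_, rfl⟩
      have h3 : f (maskedSample ω u) (maskedSample ω v) = false := by
        rw [← Bool.not_eq_true]
        intro h4
        exact absurd (h1.1 h4) (by linarith)
      exact Finset.mem_filter.2 ⟨Finset.mem_univ _, Or.inr ⟨by linarith, h3⟩⟩
    · norm_num
    · exact le_rfl
  · rw [h] at hT
    simp at hT
    linarith
  · rw [abs_of_pos h] at hT hH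
    refine le_trans (Finset.sum_le_sum fun ω _ ↦ ?_) (sum_maskedSample_bad_le hN hp0 hp u v
      (G := G) hT0.le hK _ hf hT hH)
    refine mul_le_mul_of_nonneg_left ?_ (hwt ω)
    split_ifs with h1 h2 h2
    · exact le_rfl
    · exfalso
      push Not at h2
      exact h2.2 (Finset.mem_filter.2 ⟨Finset.mem_univ _, Or.inl ⟨h2.1, h1.2 h⟩⟩)
    · norm_num
    · exact le_rfl

/-- Sampling weights on the coordinates of an `m`-bit string and two padding coordinates. -/
noncomputable def paddedWeight (m : ℕ) (r : ℝ) : Fin m ⊕ Bool → ℝ :=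
  Sum.elim (fun _ ↦ 1 / (2 * m)) fun b ↦ (1 / 2 - sgn b * (r / (2 * m))) / 2

theorem sum_paddedWeight {m : ℕ} (hm : 0 < m) (r : ℝ) : ∑ i, paddedWeight m r i = 1 := by
  have : (m : ℝ) ≠ 0 := by positivity
  simp [paddedWeight, Fintype.sum_sum_type, sgn]
  field_simp
  ring

theorem paddedWeight_nonneg {m : ℕ} (hm : 0 < m) {r : ℝ} (hr : |r| ≤ m) (i : Fin m ⊕ Bool) :
    0 ≤ paddedWeight m r i := by
  have hm' : (0 : ℝ) < m := by exact_mod_cast hm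
  rcases i with i | b
  · simp only [paddedWeight, Sum.elim_inl]; positivity
  · simp only [paddedWeight, Sum.elim_inr]
    have h1 : |sgn b * (r / (2 * m))| ≤ 1 / 2 := by
      rw [abs_mul, abs_sgn, one_mul, abs_div, abs_of_pos (by positivity : (0 : ℝ) < 2 * m),
        div_le_iff₀ (by positivity)]
      linarith
    have := (abs_le.1 h1).2
    linarith

/-- On the two padding coordinates the strings agree once and differ once, so the difference of the
padding weights moves the threshold from 0 to `r`. -/
theorem sum_paddedWeight_mul {m : ℕ} (r : ℝ) (x y : BitString m) :
    ∑ i, paddedWeight m r i * (sgn ((Sum.elim x fun _ ↦ false : Fin m ⊕ Bool → Bool) i) *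
      sgn ((Sum.elim y id : Fin m ⊕ Bool → Bool) i)) = (signInner x y - r) / (2 * m) := by
  simp only [paddedWeight, Fintype.sum_sum_type, Sum.elim_inl, Sum.elim_inr, id, Fintype.sum_bool]
  rw [← Finset.mul_sum]
  simp only [sgn, signInner, if_true, Bool.false_eq_true, if_false]
  ring

/-- A function with few errors on large inputs decides a threshold on small inputs. -/
theorem exists_threshold_simulation (hN : 0 < N) {m : ℕ} (hm : 0 < m) {r : ℝ} (hr : |r| ≤ m)
    {G T H K ε : ℝ} (hT0 : 0 < T) (hK : 0 ≤ K) (f : BitString N → BitString N → Bool)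
    (hf : ((gapErrors G f).card : ℝ) ≤ ε * 4 ^ N) :
    ∃ φ ψ : BitString m → BitString N,
      ((Finset.univ.filter fun q : BitString m × BitString m ↦
        (T ≤ |(signInner q.1 q.2 - r) / (2 * m)| * √(N : ℝ) ∧
          |(signInner q.1 q.2 - r) / (2 * m)| * √(N : ℝ) ≤ H) ∧
          (f (φ q.1) (ψ q.2) = true ↔ 0 < (signInner q.1 q.2 - r) / (2 * m))).card : ℝ) ≤
        simError G T H K ε * 4 ^ m := by
  classical
  set p := paddedWeight m r with hp
  have hp0 := paddedWeight_nonneg hm hr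
  have hp1 := sum_paddedWeight hm r
  let X : BitString m → Fin m ⊕ Bool → Bool := fun x ↦ Sum.elim x fun _ ↦ false
  let Y : BitString m → Fin m ⊕ Bool → Bool := fun y ↦ Sum.elim y id
  let wt : (Fin N → (Fin m ⊕ Bool) × Bool) → ℝ := fun ω ↦ ∏ j, p (ω j).1 / 2
  let good : BitString m × BitString m → Prop := fun q ↦
    T ≤ |(signInner q.1 q.2 - r) / (2 * m)| * √(N : ℝ) ∧
          |(signInner q.1 q.2 - r) / (2 * m)| * √(N : ℝ) ≤ H
  let err : (Fin N → (Fin m ⊕ Bool) × Bool) → BitString m × BitString m → Prop := fun ω q ↦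
    (f (maskedSample ω (X q.1)) (maskedSample ω (Y q.2)) = true ↔
      0 < (signInner q.1 q.2 - r) / (2 * m))
  have hwt : ∀ ω, 0 ≤ wt ω := fun ω ↦
    Finset.prod_nonneg fun j _ ↦ div_nonneg (hp0 _) (by norm_num)
  have hwt1 : ∑ ω, wt ω = 1 := by
    have h1 : ∑ a : (Fin m ⊕ Bool) × Bool, p a.1 / 2 = 1 := by
      rw [Fintype.sum_prod_type, ← hp1]
      refine Finset.sum_congr rfl fun a _ ↦ ?_
      rw [Fintype.sum_bool]
      ring
    have := Fintype.sum_pow (fun a : (Fin m ⊕ Bool) × Bool ↦ p a.1 / 2) N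
    rw [h1, one_pow] at this
    exact this.symm
  have hone : ∀ q, good q → ∑ ω, wt ω * (if err ω q then 1 else 0) ≤ simError G T H K ε := by
    intro q hq
    have h1 := sum_paddedWeight_mul r q.1 q.2
    have h2 := sum_maskedSample_error_le hN hp0 hp1 (X q.1) (Y q.2) (T := T) (H := H) hT0 hK f hf
      (by rw [h1]; exact hq.1) (by rw [h1]; exact hq.2)
    rw [h1] at h2
    exact h2
  -- Averaging over `ω`: every good pair is decided wrongly with probability at most `simError`, so
  -- some fixed `ω` is wrong on few good pairs, and sampling with it gives `φ` and `ψ`.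
  by_contra! hcon
  have hε0 : 0 ≤ simError G T H K ε := by
    have : 0 ≤ ε := by
      have h4 : (0 : ℝ) < 4 ^ N := by positivity
      have h5 : (0 : ℝ) ≤ ε * 4 ^ N := le_trans (by positivity) hf
      exact nonneg_of_mul_nonneg_left h5 h4
    unfold simError
    positivity
  have hlow : simError G T H K ε * 4 ^ m <
      ∑ ω, wt ω * ∑ q with good q, (if err ω q then (1 : ℝ) else 0) := by
    have h3 : ∀ ω, simError G T H K ε * 4 ^ m <
        ∑ q with good q, (if err ω q then (1 : ℝ) else 0) := by
      intro ω
      refine (hcon (fun x ↦ maskedSample ω (X x)) (fun y ↦ maskedSample ω (Y y))).trans_eq ?_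
      rw [← Finset.filter_filter, Finset.card_filter]
      push_cast
      rfl
    have hex : ∃ ω, 0 < wt ω := by
      by_contra! h0
      have : ∑ ω, wt ω ≤ 0 := Finset.sum_nonpos fun ω _ ↦ h0 ω
      linarith
    obtain ⟨ω₀, hω₀⟩ := hex
    calc simError G T H K ε * 4 ^ m = ∑ ω, wt ω * (simError G T H K ε * 4 ^ m) := by
          rw [← Finset.sum_mul, hwt1, one_mul]
      _ < _ := by
          refine Finset.sum_lt_sum (fun ω _ ↦ mul_le_mul_of_nonneg_left (h3 ω).le (hwt ω))
            ⟨ω₀, Finset.mem_univ _, mul_lt_mul_of_pos_left (h3 ω₀) hω₀⟩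
  have hup : ∑ ω, wt ω * ∑ q with good q, (if err ω q then (1 : ℝ) else 0) ≤
      simError G T H K ε * 4 ^ m := by
    simp_rw [Finset.mul_sum]
    rw [Finset.sum_comm]
    refine (Finset.sum_le_card_nsmul _ _ (simError G T H K ε) fun q hq ↦
      hone q (Finset.mem_filter.1 hq).2).trans ?_
    rw [nsmul_eq_mul, mul_comm]
    refine mul_le_mul_of_nonneg_left ?_ hε0
    have h6 := Finset.card_le_univ (Finset.univ.filter good)
    have h7 : Fintype.card (BitString m × BitString m) = 4 ^ m := by
      simp [← mul_pow]
    rw [h7] at h6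
    exact_mod_cast h6
  linarith

/-- The Chernoff bound at bias 0, where `biasedWeight` is the uniform density. -/
theorem card_signInner_large_le {m : ℕ} (hm : 0 < m) (M : ℝ) :
    ((Finset.univ.filter fun q : BitString m × BitString m ↦
      M * √(m : ℝ) < |signInner q.1 q.2|).card : ℝ) ≤ 2 * Real.exp (1 - M) * 4 ^ m := by
  classical
  have hN1 : (1 : ℝ) ≤ m := by exact_mod_cast hm
  set r := √(m : ℝ) with hr
  have hr1 : 1 ≤ r := Real.one_le_sqrt.2 hN1
  have hrr : r * r = m := Real.mul_self_sqrt (by positivity)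
  have hr0 : 0 < r := by linarith
  have ht1 : 1 / r ≤ 1 := by rw [div_le_one hr0]; exact hr1
  have m1 := sum_biasedWeight_mul_exp_neg_le (N := m) le_rfl zero_le_one
    (by positivity : 0 ≤ 1 / r) ht1
  have m2 := sum_biasedWeight_mul_exp_pos_le (N := m) le_rfl (by positivity : 0 ≤ 1 / r) ht1
  have hb : ∀ q : BitString m × BitString m, biasedWeight 0 q = 1 / 4 ^ m := by
    intro q; simp [biasedWeight]
  have x1 : (m : ℝ) * ((1 / r) ^ 2 - 0 * (1 / r)) = 1 := by
    rw [← hrr]; field_simp; ring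
  have x2 : (m : ℝ) * ((1 / r) ^ 2 + 2 * 0 * (1 / r)) = 1 := by
    rw [← hrr]; field_simp; ring
  rw [x1] at m1
  rw [x2] at m2
  simp only [hb] at m1 m2
  rw [← Finset.mul_sum, one_div_mul_eq_div, div_le_iff₀ (by positivity)] at m1 m2
  have hpt : ∀ q : BitString m × BitString m, (if M * r < |signInner q.1 q.2| then (1 : ℝ) else 0) ≤
      Real.exp (-M) * Real.exp (-(1 / r) * signInner q.1 q.2) +
        Real.exp (-M) * Real.exp (1 / r * signInner q.1 q.2) := by
    intro q
    rw [← Real.exp_add, ← Real.exp_add]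
    split_ifs with h
    · rcases lt_abs.1 h with h1 | h1
      · have : 1 ≤ Real.exp (-M + 1 / r * signInner q.1 q.2) := by
          apply Real.one_le_exp
          have : M ≤ 1 / r * signInner q.1 q.2 := by
            rw [one_div_mul_eq_div, le_div_iff₀ hr0]; exact h1.le
          linarith
        have := Real.exp_pos (-M + -(1 / r) * signInner q.1 q.2)
        linarith
      · have : 1 ≤ Real.exp (-M + -(1 / r) * signInner q.1 q.2) := by
          apply Real.one_le_exp
          have : M ≤ 1 / r * -signInner q.1 q.2 := by
            rw [one_div_mul_eq_div, le_div_iff₀ hr0]; exact h1.le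
          linarith
        have := Real.exp_pos (-M + 1 / r * signInner q.1 q.2)
        linarith
    · positivity
  rw [Finset.card_filter]
  push_cast
  refine (Finset.sum_le_sum fun q _ ↦ hpt q).trans ?_
  rw [Finset.sum_add_distrib, ← Finset.mul_sum, ← Finset.mul_sum]
  calc _ ≤ Real.exp (-M) * (Real.exp 1 * 4 ^ m) + Real.exp (-M) * (Real.exp 1 * 4 ^ m) := by
        gcongr
    _ = _ := by
        rw [sub_eq_add_neg, Real.exp_add]; ring

end Simulation

/-! ### Constant distributional error of short transcripts -/

section Core

theorem exists_nat_exp_sub_le (a : ℝ) {η : ℝ} (hη : 0 < η) :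
    ∃ n : ℕ, 0 < n ∧ Real.exp (a - n) ≤ η := by
  obtain ⟨n, hn⟩ := exists_nat_gt (a - Real.log η)
  refine ⟨n + 1, n.succ_pos, ?_⟩
  rw [← Real.le_log_iff_exp_le hη]
  push_cast
  linarith

/-- The thresholds have spacing `u / 128`, and answers are reliable at distance `u / 256`. If `S₀ -
S > u / 64`, the first threshold above `S + u / 256` is reliable for both values and separates them,
although both agree with the same answers. -/
theorem sub_le_of_thresholds {u : ℝ} (hu : 0 < u) {M R : ℕ} (hR : R = 256 * M + 1) {S S₀ : ℝ} (hS : |S| ≤ M * u)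
    (hS₀ : |S₀| ≤ M * u) (β : Fin R → Prop)
    (hβ : ∀ i : Fin R, u / 256 ≤ |S - (-M + (i : ℕ) / 128) * u| → (β i ↔ S < (-M + (i : ℕ) / 128) * u))
    (hβ₀ : ∀ i : Fin R, u / 256 ≤ |S₀ - (-M + (i : ℕ) / 128) * u| →
      (β i ↔ S₀ < (-M + (i : ℕ) / 128) * u)) : S₀ - S ≤ u / 64 := by
  by_contra! h
  have hS' := (abs_le.1 hS).1
  have hS₀' := (abs_le.1 hS₀).2
  set a : ℝ := 128 * (S / u + 1 / 256 + M) with ha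
  have hSu : S / u * u = S := by field_simp
  have ha0 : 0 ≤ a := by
    have : -(M : ℝ) ≤ S / u := by rw [le_div_iff₀ hu]; linarith
    rw [ha]; linarith
  have h1 := Nat.le_ceil a
  have h2 := Nat.ceil_lt_add_one ha0
  set i := ⌈a⌉₊ with hi
  set r : ℝ := (-M + (i : ℕ) / 128) * u with hr
  have hr1 : S + u / 256 ≤ r := by
    have : (a / 128 - M) * u ≤ r := by
      rw [hr]; apply mul_le_mul_of_nonneg_right _ hu.le; linarith
    have h3 : (a / 128 - M) * u = S / u * u + u / 256 := by rw [ha]; ring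
    rw [hSu] at h3
    linarith
  have hr2 : r ≤ S + u / 256 + u / 128 := by
    have : r ≤ (a / 128 - M + 1 / 128) * u := by
      rw [hr]; apply mul_le_mul_of_nonneg_right _ hu.le; linarith
    have h3 : (a / 128 - M + 1 / 128) * u = S / u * u + u / 256 + u / 128 := by rw [ha]; ring
    rw [hSu] at h3
    linarith
  have hiM : i < R := by
    have h4 : r ≤ M * u := by linarith
    have h5 := le_of_mul_le_mul_right h4 hu
    have h6 : (i : ℝ) ≤ 256 * M := by linarith
    have : i ≤ 256 * M := by exact_mod_cast h6
    omega
  have k1 := hβ ⟨i, hiM⟩ (by rw [abs_sub_comm]; exact le_trans (by linarith) (le_abs_self _))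
  have k2 := hβ₀ ⟨i, hiM⟩ (le_trans (by linarith) (le_abs_self _))
  have k3 : S < r := by linarith
  have k4 : S₀ < r := k2.1 (k1.2 k3)
  linarith

set_option maxHeartbeats 800000 in
/-- Gap-Hamming functions of short transcripts have a constant error under the uniform
distribution. -/
theorem exists_lt_card_gapErrors (G : ℝ) : ∃ ε δ : ℝ, 0 < ε ∧ 0 < δ ∧ ∃ n₀ : ℕ, ∀ N, n₀ ≤ N →
    ∀ (Λ : Type) [Fintype Λ] (tr : BitString N → BitString N → Λ) (out : Λ → Bool),
      IsTranscript tr → (Fintype.card Λ : ℝ) ≤ 2 ^ (δ * N) →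
      ε * 4 ^ N < (gapErrors G fun x y ↦ out (tr x y)).card := by
  classical
  -- The order of choice matters: `M` cuts off large inner products and fixes the number `R` of
  -- thresholds; then `T`, `K` and `ε` in turn make each term of `simError` at most `η`.
  obtain ⟨M, hM0, hM⟩ := exists_nat_exp_sub_le 1 (by norm_num : (0 : ℝ) < 1 / 32768)
  obtain ⟨R, hR⟩ : ∃ R, R = 256 * M + 1 := ⟨_, rfl⟩
  have hR0 : (0 : ℝ) < R := by rw [hR]; push_cast; positivity
  set η : ℝ := 1 / (8192 * 3 * R) with hη
  have hη0 : 0 < η := by positivity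
  obtain ⟨T, hT0, hT⟩ := exists_nat_exp_sub_le (1 + G) hη0
  -- With `√N` between `τ * u` and `2 * τ * u`, a distance of at least `u / 256` from the threshold
  -- gives a normalized correlation of at least `τ / 512 = T`, and a distance of at most `2 * M * u`
  -- gives at most `H`.
  set τ := 512 * T with hτ
  have hτ0 : 0 < τ := by omega
  set H : ℝ := 2 * M * τ with hH
  obtain ⟨K, hK0, hK⟩ := exists_nat_exp_sub_le (1 + 2 * H) hη0
  set ε := Real.exp (-(H * K)) * η with hε
  have hsim : simError G T H K ε ≤ 1 / (8192 * R) := by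
    have h1 : Real.exp (H * K) * ε = η := by
      rw [hε, ← mul_assoc, ← Real.exp_add]; simp
    unfold simError
    rw [h1]
    have : 1 / (8192 * R) = η + η + η := by rw [hη]; field_simp; norm_num
    linarith
  -- Since `N ≤ 8 * τ ^ 2 * k`, this `δ` leaves at most `2 ^ (k / 32)` values for `R` transcripts
  -- together. The bound on `N` ensures `k ≥ 100 * (M ^ 2 + 1)`, hence `M * u ≤ m`.
  refine ⟨ε, 1 / (256 * τ ^ 2 * R), by positivity, by positivity, 400 * τ ^ 2 * (M ^ 2 + 1), ?_⟩
  intro N hN Λ _ tr out htr hΛ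
  by_contra! hcon
  set f : BitString N → BitString N → Bool := fun x y ↦ out (tr x y) with hf
  set k := N / (4 * τ ^ 2) with hk
  obtain ⟨m, hm⟩ : ∃ m, m = 4 * k := ⟨_, rfl⟩
  have hτ2 : 0 < 4 * τ ^ 2 := by positivity
  have hkM : 100 * (M ^ 2 + 1) ≤ k := by
    rw [hk, Nat.le_div_iff_mul_le hτ2]
    refine le_trans (le_of_eq ?_) hN
    ring
  have hk100 : 100 ≤ k := by nlinarith
  have hNlow : τ ^ 2 * m ≤ N := by
    have := Nat.div_mul_le_self N (4 * τ ^ 2)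
    rw [← hk] at this
    rw [hm]; linarith
  have hNup : N ≤ 8 * τ ^ 2 * k := by
    have := Nat.lt_div_mul_add hτ2 (a := N)
    rw [← hk] at this
    nlinarith
  have hm0 : 0 < m := by omega
  have hN0 : 0 < N := lt_of_lt_of_le (by positivity) hNlow
  set u := √(m : ℝ) with hu
  have hmR : (m : ℝ) = 4 * k := by rw [hm]; push_cast; rfl
  have huu : u * u = m := Real.mul_self_sqrt (by positivity)
  have hu0 : 0 < u := Real.sqrt_pos.2 (by exact_mod_cast hm0)
  have huk : u = 2 * √(k : ℝ) := by
    rw [hu, hmR, Real.sqrt_mul (by norm_num)]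
    congr 1
    rw [show (4 : ℝ) = 2 ^ 2 by norm_num]
    exact Real.sqrt_sq (by norm_num)
  have hτR : (0 : ℝ) < τ := by exact_mod_cast hτ0
  have hs1 : τ * u ≤ √(N : ℝ) := by
    apply Real.le_sqrt_of_sq_le
    rw [mul_pow, sq u, huu]
    exact_mod_cast hNlow
  have hs2 : √(N : ℝ) ≤ 2 * τ * u := by
    rw [Real.sqrt_le_left (by positivity), mul_pow, sq u, huu, hmR]
    have : (N : ℝ) ≤ 8 * τ ^ 2 * k := by exact_mod_cast hNup
    have : (0 : ℝ) ≤ τ ^ 2 * k := by positivity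
    linarith
  have hMu : M * u ≤ m := by
    rw [← huu]
    gcongr
    apply Real.le_sqrt_of_sq_le
    have : M ^ 2 ≤ m := by nlinarith
    exact_mod_cast this
  let r : Fin R → ℝ := fun i ↦ (-M + (i : ℕ) / 128) * u
  have hr : ∀ i, |r i| ≤ M * u := by
    intro i
    have h1 : ((i : ℕ) : ℝ) ≤ 256 * M := by
      have : (i : ℕ) ≤ 256 * M := by have := i.2; omega
      exact_mod_cast this
    have h2 : (0 : ℝ) ≤ ((i : ℕ) : ℝ) := by positivity
    simp only [r]
    rw [abs_mul, abs_of_pos hu0]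
    gcongr
    rw [abs_le]
    constructor <;> linarith
  have hthr := fun i ↦ exists_threshold_simulation hN0 hm0 ((hr i).trans hMu)
    (T := T) (H := H) (K := K) (by exact_mod_cast hT0) (by positivity) f hcon
  choose φ ψ hφψ using hthr
  let errs : Fin R → Finset (BitString m × BitString m) := fun i ↦
    Finset.univ.filter fun q : BitString m × BitString m ↦
        ((T : ℝ) ≤ |(signInner q.1 q.2 - r i) / (2 * m)| * √(N : ℝ) ∧
          |(signInner q.1 q.2 - r i) / (2 * m)| * √(N : ℝ) ≤ H) ∧
          (f (φ i q.1) (ψ i q.2) = true ↔ 0 < (signInner q.1 q.2 - r i) / (2 * m))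
  let cons : (Fin R → Λ) → ℝ → Prop := fun a S ↦ |S| ≤ M * u ∧
    ∀ i, u / 256 ≤ |S - r i| → (out (a i) = true ↔ S < r i)
  -- Any value consistent with all answers is a good estimate. The default 0 occurs only for pairs
  -- that are already counted as errors.
  let est : (Fin R → Λ) → ℝ := fun a ↦ if h : ∃ S, cons a S then h.choose else 0
  let tr' : BitString m → BitString m → Fin R → Λ := fun x y i ↦ tr (φ i x) (ψ i y)
  have htr' : IsTranscript tr' := IsTranscript.pi fun i ↦ htr.comp (φ i) (ψ i)
  have hcard : 2 * (Fintype.card (Fin R → Λ) : ℝ) ≤ 2 ^ ((k : ℝ) / 16) := by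
    rw [Fintype.card_pi_const]
    push_cast
    have h1 : (Fintype.card Λ : ℝ) ^ R ≤ 2 ^ ((k : ℝ) / 32) := by
      calc (Fintype.card Λ : ℝ) ^ R ≤ (2 ^ (1 / (256 * τ ^ 2 * R) * (N : ℝ))) ^ R := by gcongr
        _ = 2 ^ (1 / (256 * τ ^ 2 * R) * (N : ℝ) * R) := by
          rw [← Real.rpow_natCast, ← Real.rpow_mul (by norm_num)]
        _ ≤ 2 ^ ((k : ℝ) / 32) := by
          apply Real.rpow_le_rpow_of_exponent_le (by norm_num)
          have h2 : (N : ℝ) ≤ 8 * τ ^ 2 * k := by exact_mod_cast hNup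
          have h3 : 1 / (256 * τ ^ 2 * R) * (N : ℝ) * R = N / (256 * τ ^ 2) := by field_simp
          rw [h3, div_le_iff₀ (by positivity)]
          linarith
    calc (2 : ℝ) * (Fintype.card Λ : ℝ) ^ R ≤ 2 ^ (1 : ℝ) * 2 ^ ((k : ℝ) / 32) := by
          rw [Real.rpow_one]; gcongr
      _ = 2 ^ (1 + (k : ℝ) / 32) := by rw [← Real.rpow_add (by norm_num)]
      _ ≤ _ := by
          apply Real.rpow_le_rpow_of_exponent_le (by norm_num)
          have : (100 : ℝ) ≤ k := by exact_mod_cast hk100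
          linarith
  have hlow := card_signInner_approx_ge hm hk100 tr' htr' est hcard
  have hsub : ((Finset.univ : Finset (BitString m × BitString m)).filter fun p ↦
      √(k : ℝ) / 32 < |signInner p.1 p.2 - est (tr' p.1 p.2)|) ⊆
      (Finset.univ.filter fun q : BitString m × BitString m ↦ M * u < |signInner q.1 q.2|) ∪
        Finset.univ.biUnion errs := by
    intro q hq
    have hq' := (Finset.mem_filter.1 hq).2
    by_contra hnot
    simp only [Finset.mem_union, Finset.mem_filter, Finset.mem_univ, true_and,
      Finset.mem_biUnion, not_or, not_lt, not_exists] at hnot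
    obtain ⟨hn1, hn2⟩ := hnot
    set S := signInner q.1 q.2 with hS
    have hcons : cons (tr' q.1 q.2) S := by
      refine ⟨hn1, fun i hi ↦ ?_⟩
      have hn3 := hn2 i
      have hm2 : (0 : ℝ) < 2 * m := by positivity
      have habs : |(S - r i) / (2 * m)| = |S - r i| / (2 * m) := by
        rw [abs_div, abs_of_pos hm2]
      have hT' : (T : ℝ) ≤ |(S - r i) / (2 * m)| * √(N : ℝ) := by
        rw [habs, div_mul_eq_mul_div, le_div_iff₀ hm2]
        calc (T : ℝ) * (2 * m) = u / 256 * (τ * u) := by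
              rw [← huu, hτ]; push_cast; ring
          _ ≤ _ := by gcongr
      have hH' : |(S - r i) / (2 * m)| * √(N : ℝ) ≤ H := by
        rw [habs, div_mul_eq_mul_div, div_le_iff₀ hm2]
        have h5 : |S - r i| ≤ 2 * (M * u) := by
          have := abs_sub S (r i)
          have := hr i
          linarith
        calc |S - r i| * √(N : ℝ) ≤ 2 * (M * u) * (2 * τ * u) := by gcongr
          _ = H * (2 * m) := by rw [← huu, hH]; ring
      have hne : S ≠ r i := by
        rintro h
        rw [h, sub_self, abs_zero] at hi
        linarith
      have h6 : ¬ (f (φ i q.1) (ψ i q.2) = true ↔ 0 < (S - r i) / (2 * m)) := fun h ↦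
        hn3 (Finset.mem_filter.2 ⟨Finset.mem_univ _, ⟨hT', hH'⟩, h⟩)
      have h7 : 0 < (S - r i) / (2 * m) ↔ r i < S := by
        rw [div_pos_iff_of_pos_right hm2, sub_pos]
      rw [h7] at h6
      change f (φ i q.1) (ψ i q.2) = true ↔ S < r i
      rcases lt_or_gt_of_ne hne with h | h
      · have : ¬ r i < S := by linarith
        tauto
      · have : ¬ S < r i := by linarith
        tauto
    have hex : ∃ S, cons (tr' q.1 q.2) S := ⟨S, hcons⟩
    have hest : est (tr' q.1 q.2) = hex.choose := dif_pos hex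
    have hcons₀ := hex.choose_spec
    rw [← hest] at hcons₀
    have b1 := sub_le_of_thresholds hu0 hR hcons.1 hcons₀.1 _ hcons.2 hcons₀.2
    have b2 := sub_le_of_thresholds hu0 hR hcons₀.1 hcons.1 _ hcons₀.2 hcons.2
    have b3 : |S - est (tr' q.1 q.2)| ≤ u / 64 := abs_le.2 ⟨by linarith, by linarith⟩
    rw [huk] at b3
    linarith
  have h4m : (0 : ℝ) < 4 ^ m := by positivity
  have hup : (((Finset.univ : Finset (BitString m × BitString m)).filter fun p ↦
      √(k : ℝ) / 32 < |signInner p.1 p.2 - est (tr' p.1 p.2)|).card : ℝ) ≤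
      2 * Real.exp (1 - M) * 4 ^ m + R * (simError G T H K ε * 4 ^ m) := by
    refine (Nat.cast_le.2 ((Finset.card_le_card hsub).trans (Finset.card_union_le _ _))).trans ?_
    push_cast
    gcongr ?_ + ?_
    · exact card_signInner_large_le hm0 M
    · calc ((Finset.univ.biUnion errs).card : ℝ) ≤ ∑ i, ((errs i).card : ℝ) := by
            exact_mod_cast Finset.card_biUnion_le
        _ ≤ ∑ _i : Fin R, simError G T H K ε * 4 ^ m := Finset.sum_le_sum fun i _ ↦ hφψ i
        _ = _ := by rw [Finset.sum_const, Finset.card_univ, Fintype.card_fin, nsmul_eq_mul]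
  have h9 : R * (simError G T H K ε * 4 ^ m) ≤ 1 / 8192 * 4 ^ m := by
    calc R * (simError G T H K ε * 4 ^ m) ≤ R * (1 / (8192 * R) * 4 ^ m) := by gcongr
      _ = _ := by field_simp
  have h10 : 2 * Real.exp (1 - M) * 4 ^ m ≤ 2 * (1 / 32768) * (4 : ℝ) ^ m := by gcongr
  -- The upper bound `1 / 16384 + 1 / 8192` for the fraction of bad pairs is below the lower bound
  -- `1 / 4096`.
  linarith

end Core

/-! ### Error reduction for randomized protocols -/

section Amplification

/-- The expected weight of the errors is at most a third of the total weight, so some outcome does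
no worse. -/
theorem PMF.exists_three_mul_sum_le {α Z : Type*} [Fintype Z] (P : PMF α) (err : α → Z → Prop)
    [∀ a z, Decidable (err a z)] (h : ∀ z, P.toOuterMeasure {a | err a z} ≤ 1 / 3) (w : Z → ℕ) :
    ∃ a, 3 * ∑ z, (if err a z then w z else 0) ≤ ∑ z, w z := by
  by_contra! hcon
  have hlt : ∑' a, P a * ((∑ z, w z : ℕ) : ℝ≥0∞) <
      ∑' a, P a * ((3 * ∑ z, (if err a z then w z else 0) : ℕ) : ℝ≥0∞) := by
    obtain ⟨a, ha⟩ := P.support_nonempty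
    refine ENNReal.tsum_lt_tsum (i := a) ?_ (fun b ↦ ?_) ?_
    · rw [ENNReal.tsum_mul_right, P.tsum_coe, one_mul]
      exact ENNReal.natCast_ne_top _
    · gcongr
      exact (hcon b).le
    · exact ENNReal.mul_lt_mul_right ((P.mem_support_iff a).1 ha) (P.apply_ne_top a)
        (by exact_mod_cast hcon a)
  have hle : ∑' a, P a * ((3 * ∑ z, (if err a z then w z else 0) : ℕ) : ℝ≥0∞) ≤
      ((∑ z, w z : ℕ) : ℝ≥0∞) := by
    have h1 : ∀ a, P a * ((3 * ∑ z, (if err a z then w z else 0) : ℕ) : ℝ≥0∞) =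
        ∑ z, 3 * (w z : ℝ≥0∞) * Set.indicator {a | err a z} P a := by
      intro a
      push_cast
      rw [Finset.mul_sum, Finset.mul_sum]
      refine Finset.sum_congr rfl fun z _ ↦ ?_
      by_cases hz : err a z
      · simp only [hz, if_true, Set.indicator, Set.mem_ofPred_eq]; ring
      · simp [hz]
    simp_rw [h1]
    rw [Summable.tsum_finsetSum fun _ _ ↦ ENNReal.summable]
    push_cast
    refine Finset.sum_le_sum fun z _ ↦ ?_
    rw [ENNReal.tsum_mul_left, ← P.toOuterMeasure_apply]
    calc 3 * (w z : ℝ≥0∞) * P.toOuterMeasure {a | err a z} ≤ 3 * (w z : ℝ≥0∞) * (1 / 3) := by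
          gcongr; exact h z
      _ = w z * (3 * 3⁻¹) := by rw [one_div]; ring
      _ = w z := by rw [ENNReal.mul_inv_cancel (by norm_num) (by norm_num), mul_one]
  rw [ENNReal.tsum_mul_right, P.tsum_coe, one_mul] at hlt
  exact absurd hle (not_le.2 hlt)

/-- Multiplicative weights: outcomes are picked one at a time and the weight of `z` doubles whenever
the pick errs on it. By `PMF.exists_three_mul_sum_le`, the total weight can be kept from growing by
more than a factor 4/3 per step. -/
theorem PMF.exists_tuple_sum_prod_le {α Z : Type*} [Fintype Z] (P : PMF α) (err : α → Z → Prop)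
    [∀ a z, Decidable (err a z)] (h : ∀ z, P.toOuterMeasure {a | err a z} ≤ 1 / 3) (t : ℕ) :
    ∃ as : Fin t → α, 3 ^ t * ∑ z, ∏ i, (if err (as i) z then 2 else 1) ≤
      4 ^ t * Fintype.card Z := by
  induction t with
  | zero => exact ⟨Fin.elim0, by simp⟩
  | succ t ih =>
    obtain ⟨as, has⟩ := ih
    set w : Z → ℕ := fun z ↦ ∏ i, (if err (as i) z then 2 else 1) with hw
    obtain ⟨a, ha⟩ := P.exists_three_mul_sum_le err h w
    refine ⟨Fin.cons a as, ?_⟩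
    have h1 : ∑ z, ∏ i, (if err ((Fin.cons a as : Fin (t + 1) → α) i) z then 2 else 1) =
        ∑ z, w z + ∑ z, (if err a z then w z else 0) := by
      rw [← Finset.sum_add_distrib]
      refine Finset.sum_congr rfl fun z _ ↦ ?_
      rw [Fin.prod_univ_succ]
      simp only [Fin.cons_zero, Fin.cons_succ]
      split_ifs <;> simp [hw, two_mul]
    rw [h1, pow_succ, pow_succ]
    calc 3 ^ t * 3 * (∑ z, w z + ∑ z, (if err a z then w z else 0))
        = 3 ^ t * (3 * ∑ z, w z + 3 * ∑ z, (if err a z then w z else 0)) := by ring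
      _ ≤ 3 ^ t * (3 * ∑ z, w z + ∑ z, w z) := by gcongr
      _ = 4 * (3 ^ t * ∑ z, w z) := by ring
      _ ≤ 4 * (4 ^ t * Fintype.card Z) := by gcongr
      _ = _ := by ring

/-- Error reduction by independent repetitions: in some tuple, a majority errs on few inputs. -/
theorem PMF.exists_tuple_card_majority_le {α Z : Type*} [Fintype Z] (P : PMF α)
    (err : α → Z → Prop) [∀ a z, Decidable (err a z)]
    (h : ∀ z, P.toOuterMeasure {a | err a z} ≤ 1 / 3) (r : ℕ) :
    ∃ as : Fin (2 * r) → α, ((Finset.univ.filter fun z ↦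
        r ≤ (Finset.univ.filter fun i ↦ err (as i) z).card).card : ℝ) ≤
      (8 / 9) ^ r * Fintype.card Z := by
  obtain ⟨as, has⟩ := P.exists_tuple_sum_prod_le err h (2 * r)
  refine ⟨as, ?_⟩
  set S := Finset.univ.filter fun z ↦ r ≤ (Finset.univ.filter fun i ↦ err (as i) z).card with hS
  -- An input with at least `r` errors has weight at least `2 ^ r`, and `(4 / 3) ^ (2 * r) / 2 ^ r =
  -- (8 / 9) ^ r`.
  have h1 : S.card * 2 ^ r ≤ ∑ z, ∏ i, (if err (as i) z then 2 else 1) := by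
    rw [← smul_eq_mul]
    refine (Finset.card_nsmul_le_sum S (fun z ↦ ∏ i, (if err (as i) z then 2 else 1)) (2 ^ r)
      fun z hz ↦ ?_).trans (Finset.sum_le_sum_of_subset (Finset.subset_univ _))
    rw [Finset.prod_ite, Finset.prod_const, Finset.prod_const_one, mul_one]
    exact Nat.pow_le_pow_right (by norm_num) (Finset.mem_filter.1 hz).2
  have h2 : 3 ^ (2 * r) * (S.card * 2 ^ r) ≤ 4 ^ (2 * r) * Fintype.card Z :=
    (Nat.mul_le_mul_left _ h1).trans has
  have h3 : (3 : ℝ) ^ (2 * r) * (S.card * 2 ^ r) ≤ 4 ^ (2 * r) * Fintype.card Z := by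
    exact_mod_cast h2
  rw [pow_mul, pow_mul] at h3
  have e1 : (8 / 9 : ℝ) ^ r * (((3 : ℝ) ^ 2) ^ r * 2 ^ r) = (4 ^ 2) ^ r := by
    rw [← mul_pow, ← mul_pow]; norm_num
  have h4 : (0 : ℝ) < ((3 : ℝ) ^ 2) ^ r * 2 ^ r := by positivity
  refine le_of_mul_le_mul_left ?_ h4
  calc _ = ((3 : ℝ) ^ 2) ^ r * (S.card * 2 ^ r) := by ring
    _ ≤ (4 ^ 2) ^ r * Fintype.card Z := h3
    _ = _ := by rw [← e1]; ring

end Amplification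

/-! ### Leaves of protocol trees -/

section Protocols

/-- The possible sequences of `k` messages together with the output bit. -/
def Leaves (s : ℕ) : ℕ → Type
  | 0 => Bool
  | k + 1 => Message s × Leaves s k

instance Leaves.instFintype (s : ℕ) : (k : ℕ) → Fintype (Leaves s k)
  | 0 => inferInstanceAs (Fintype Bool)
  | k + 1 =>
    letI := Leaves.instFintype s k
    inferInstanceAs (Fintype (Message s × Leaves s k))

/-- The output bit of a leaf. -/
def Leaves.bit {s : ℕ} : {k : ℕ} → Leaves s k → Bool
  | 0, b => b
  | _ + 1, l => Leaves.bit l.2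

variable {n s : ℕ}

/-- The messages and the output bit of a run of a protocol. -/
def Protocol.leaf : {k : ℕ} → Protocol n s k → BitString n → BitString n → Leaves s k
  | _, .output out, own, _ => out own
  | _, .round msg next, own, other => (msg own, (next (msg own)).leaf other own)

theorem Protocol.bit_leaf {k : ℕ} (Q : Protocol n s k) (x y : BitString n) :
    (Q.leaf x y).bit = Q.eval x y := by
  induction Q generalizing x y with
  | output out => rfl
  | round msg next ih => exact ih _ y x

theorem Protocol.isTranscript_leaf {k : ℕ} (Q : Protocol n s k) : IsTranscript Q.leaf := by
  induction Q with
  | output out => intro x x' y y' _; rfl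
  | round msg next ih =>
    intro x x' y y' h
    have h1 : msg x = msg x' := congrArg Prod.fst h
    have h2 : (next (msg x)).leaf y x = (next (msg x')).leaf y' x' := congrArg Prod.snd h
    rw [← h1] at h2
    refine Prod.ext rfl ?_
    change (next (msg x)).leaf y' x = (next (msg x)).leaf y x
    rw [h2]
    -- The players have swapped roles, so the induction hypothesis is used at the opposite corner of
    -- the rectangle.
    exact ih _ y' y x' x h2.symm

theorem card_message_lt (s : ℕ) : Fintype.card (Message s) < 2 ^ (s + 1) := by
  rw [Fintype.card_sigma]
  simp only [Fintype.card_pi, Fintype.card_bool, Finset.prod_const, Finset.card_univ,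
    Fintype.card_fin]
  rw [Fin.sum_univ_eq_sum_range (fun l ↦ 2 ^ l)]
  exact Nat.geomSum_lt (le_refl 2) fun _ h ↦ Finset.mem_range.1 h

theorem card_leaves (s k : ℕ) : Fintype.card (Leaves s k) = 2 * Fintype.card (Message s) ^ k := by
  induction k with
  | zero => exact Fintype.card_bool
  | succ k ih =>
    have : Fintype.card (Leaves s (k + 1)) = Fintype.card (Message s) * Fintype.card (Leaves s k) :=
      Fintype.card_prod (Message s) (Leaves s k)
    rw [this, ih, pow_succ]
    ring

theorem card_leaves_of_trivial {s k : ℕ} (h : s = 0 ∨ k = 0) : Fintype.card (Leaves s k) = 2 := by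
  rw [card_leaves]
  rcases h with rfl | rfl
  · have h1 := card_message_lt 0
    have h2 : 0 < Fintype.card (Message 0) := Fintype.card_pos_iff.2 ⟨⟨0, fun _ ↦ false⟩⟩
    have : Fintype.card (Message 0) = 1 := by omega
    simp [this]
  · simp

theorem card_leaves_le {s k : ℕ} (hs : 0 < s) (hk : 0 < k) :
    Fintype.card (Leaves s k) ≤ 2 ^ (3 * (s * k)) := by
  rw [card_leaves]
  calc 2 * Fintype.card (Message s) ^ k ≤ 2 * (2 ^ (s + 1)) ^ k := by
        gcongr; exact (card_message_lt s).le
    _ = 2 ^ (1 + (s + 1) * k) := by rw [← pow_mul, pow_add, pow_one]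
    _ ≤ _ := by
        apply Nat.pow_le_pow_right (by norm_num)
        have : 1 ≤ s * k := Nat.mul_pos hs hk
        have : k ≤ s * k := Nat.le_mul_of_pos_left k hs
        nlinarith

/-- Here the linear bound on total communication becomes the stated one: one factor `2 ^ (k ^ 2)`
pays for the number `k` of rounds, the rest for the `t` copies and for `δ`. -/
theorem card_leaves_pow_le {s k n t C : ℕ} {δ : ℝ} (hs : 0 < s) (hk : 0 < k)
    (hC : 3 * t / 2 ^ C ≤ δ) (h : (s : ℝ) < n / 2 ^ ((C + 1) * k ^ 2)) :
    (Fintype.card (Leaves s k) : ℝ) ^ t ≤ 2 ^ (δ * n) := by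
  have h1 : (Fintype.card (Leaves s k) : ℝ) ≤ 2 ^ (3 * (s * k)) := by
    exact_mod_cast card_leaves_le hs hk
  calc (Fintype.card (Leaves s k) : ℝ) ^ t ≤ (2 ^ (3 * (s * k))) ^ t := by gcongr
    _ = (2 : ℝ) ^ ((3 * (s * k) * t : ℕ) : ℝ) := by rw [← pow_mul, Real.rpow_natCast]
    _ ≤ _ := by
      apply Real.rpow_le_rpow_of_exponent_le (by norm_num)
      push_cast
      have hk2 : (k : ℝ) ≤ 2 ^ (k ^ 2) := by
        have h2 : k ≤ k ^ 2 := Nat.le_self_pow two_ne_zero k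
        have h3 : k ^ 2 < 2 ^ (k ^ 2) := Nat.lt_two_pow_self
        exact_mod_cast h2.trans h3.le
      have hCk : (2 : ℝ) ^ C ≤ 2 ^ (C * k ^ 2) := by
        apply pow_le_pow_right₀ (by norm_num)
        exact Nat.le_mul_of_pos_right C (by positivity)
      have h4 : (2 : ℝ) ^ ((C + 1) * k ^ 2) = 2 ^ (C * k ^ 2) * 2 ^ (k ^ 2) := by
        rw [← pow_add]; congr 1; ring
      rw [h4] at h
      have h5 : (s : ℝ) * k ≤ n / 2 ^ C := by
        rw [lt_div_iff₀ (by positivity)] at h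
        rw [le_div_iff₀ (by positivity)]
        calc (s : ℝ) * k * 2 ^ C ≤ s * 2 ^ (k ^ 2) * 2 ^ (C * k ^ 2) := by gcongr
          _ = s * (2 ^ (C * k ^ 2) * 2 ^ (k ^ 2)) := by ring
          _ ≤ n := h.le
      calc 3 * ((s : ℝ) * k) * t ≤ 3 * (n / 2 ^ C) * t := by gcongr
        _ = 3 * t / 2 ^ C * n := by ring
        _ ≤ δ * n := by gcongr

/-- The only message of length 0 is the empty one, so the output depends on the announcing player's
input alone; for `s = 0`, the parity of `k` decides who that is. -/
theorem Protocol.eval_one_sided {k : ℕ} (h : s = 0 ∨ k = 0) :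
    (∀ (Q : Protocol n s k) x y y', Q.eval x y = Q.eval x y') ∨
      ∀ (Q : Protocol n s k) x x' y, Q.eval x y = Q.eval x' y := by
  rcases h with rfl | rfl
  · have hsub : ∀ a b : Message 0, a = b := by
      have h1 := card_message_lt 0
      have : Fintype.card (Message 0) ≤ 1 := by omega
      exact fun a b ↦ (Fintype.card_le_one_iff_subsingleton.1 this).elim a b
    induction k with
    | zero => exact Or.inl fun Q x y y' ↦ by cases Q; rfl
    | succ k ih =>
      rcases ih with ih | ih
      · refine Or.inr fun Q x x' y ↦ ?_
        cases Q with
        | round msg next =>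
          change (next (msg x)).eval y x = (next (msg x')).eval y x'
          rw [hsub (msg x) (msg x')]
          exact ih _ _ _ _
      · refine Or.inl fun Q x y y' ↦ ?_
        cases Q with
        | round msg next => exact ih _ _ _ _
  · exact Or.inl fun Q x y y' ↦ by cases Q; rfl

end Protocols

/-! ### Errors for gap-Hamming distance -/

section GapHamming

variable {n : ℕ}

theorem signInner_eq (x y : BitString n) : signInner x y = n - 2 * hammingDist x y := by
  have h1 : ∀ j, sgn (x j) * sgn (y j) = 1 - 2 * if x j ≠ y j then 1 else 0 := by
    intro j
    cases x j <;> cases y j <;> simp [sgn] <;> norm_num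
  rw [signInner, Finset.sum_congr rfl fun j _ ↦ h1 j, Finset.sum_sub_distrib, ← Finset.mul_sum]
  simp only [hammingDist, Finset.card_filter]
  simp

theorem ghd_eq_false {c : ℝ} (hc : 0 < c) (hn : 0 < n) {x y : BitString n}
    (h : (hammingDist x y : ℝ) ≤ n / 2 - c * √(n : ℝ)) : ghd c n x y = some false := by
  have : 0 < c * √(n : ℝ) := mul_pos hc (Real.sqrt_pos.2 (by exact_mod_cast hn))
  rw [ghd, if_neg (by linarith), if_pos h]

theorem ghd_eq_true {c : ℝ} {x y : BitString n}
    (h : (n : ℝ) / 2 + c * √(n : ℝ) ≤ hammingDist x y) : ghd c n x y = some true := by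
  rw [ghd, if_pos h]

theorem ghd_of_two_mul_le {c c₀ : ℝ} (hc : 0 < c) (hcc : c ≤ c₀) (hn : 0 < n) {x y : BitString n}
    (h : 2 * c₀ * √(n : ℝ) ≤ signInner x y) : ghd c n x y = some false := by
  rw [signInner_eq] at h
  have := mul_le_mul_of_nonneg_right hcc (Real.sqrt_nonneg n)
  exact ghd_eq_false hc hn (by linarith)

theorem ghd_of_le_neg_two_mul {c c₀ : ℝ} (hcc : c ≤ c₀) {x y : BitString n}
    (h : signInner x y ≤ -(2 * c₀ * √(n : ℝ))) : ghd c n x y = some true := by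
  rw [signInner_eq] at h
  have := mul_le_mul_of_nonneg_right hcc (Real.sqrt_nonneg n)
  exact ghd_eq_true (by linarith)

theorem matches_some_iff (b v : Bool) : Matches b (some v) ↔ v = b := by
  simp [Matches]

theorem not_matches_of_mem_gapErrors {c c₀ : ℝ} (hc : 0 < c) (hcc : c ≤ c₀) (hn : 0 < n)
    (f : BitString n → BitString n → Bool) {p : BitString n × BitString n}
    (hp : p ∈ gapErrors (2 * c₀) f) : ¬ Matches (f p.1 p.2) (ghd c n p.1 p.2) := by
  rcases (Finset.mem_filter.1 hp).2 with ⟨h1, h2⟩ | ⟨h1, h2⟩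
  · rw [ghd_of_two_mul_le hc hcc hn h1, matches_some_iff, h2]; simp
  · rw [ghd_of_le_neg_two_mul hcc h1, matches_some_iff, h2]; simp

theorem ghd_self {c : ℝ} (hc : 0 < c) (hn : 0 < n) (h : 2 * c ≤ √(n : ℝ)) (x : BitString n) :
    ghd c n x x = some false := by
  refine ghd_eq_false hc hn ?_
  have := mul_le_mul_of_nonneg_right h (Real.sqrt_nonneg n)
  rw [Real.mul_self_sqrt (by positivity)] at this
  simp
  linarith

theorem ghd_of_forall_ne {c : ℝ} (h : 2 * c ≤ √(n : ℝ)) {x y : BitString n}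
    (hxy : ∀ i, x i ≠ y i) : ghd c n x y = some true := by
  refine ghd_eq_true ?_
  have := mul_le_mul_of_nonneg_right h (Real.sqrt_nonneg n)
  rw [Real.mul_self_sqrt (by positivity)] at this
  have hd : hammingDist x y = n := by simp [hammingDist, hxy]
  rw [hd]
  linarith

/-- Without communication, all protocols err on one of two fixed inputs. -/
theorem exists_inputs_not_matches {s k : ℕ} (hsk : s = 0 ∨ k = 0) {c : ℝ} (hc : 0 < c) (hn : 0 < n)
    (h : 2 * c ≤ √(n : ℝ)) : ∃ x y x' y' : BitString n, ∀ Q : Protocol n s k,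
      ¬ Matches (Q.eval x y) (ghd c n x y) ∨ ¬ Matches (Q.eval x' y') (ghd c n x' y') := by
  let x : BitString n := fun _ ↦ false
  let z : BitString n := fun _ ↦ true
  rcases Protocol.eval_one_sided (n := n) hsk with h1 | h1
  · refine ⟨x, x, x, z, fun Q ↦ ?_⟩
    rw [ghd_self hc hn h, ghd_of_forall_ne h (by simp [x, z]), h1 Q x x z, matches_some_iff,
      matches_some_iff]
    cases Q.eval x z <;> simp
  · refine ⟨x, x, z, x, fun Q ↦ ?_⟩
    rw [ghd_self hc hn h, ghd_of_forall_ne h (by simp [x, z]), h1 Q x z x, matches_some_iff,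
      matches_some_iff]
    cases Q.eval z x <;> simp

/-- Serves both input distributions: the errors lie in the support `D` in either case, and replacing
`D` by all of `Ω` only weakens the bound. If `D` is empty, so is `S`. -/
theorem card_le_of_uniformOn_le {Ω : Type*} [Fintype Ω] [MeasurableSpace Ω]
    [MeasurableSingletonClass Ω] {D : Set Ω} (S : Finset Ω) (hSD : (S : Set Ω) ⊆ D) {ε : ℝ}
    (hε : 0 ≤ ε) (h : uniformOn D (S : Set Ω) ≤ ENNReal.ofReal ε) :
    (S.card : ℝ) ≤ ε * Fintype.card Ω := by
  classical
  rcases S.eq_empty_or_nonempty with rfl | hS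
  · simp only [Finset.card_empty, Nat.cast_zero]; positivity
  · have hD : D.Finite := Set.toFinite D
    have hD0 : D.Nonempty := (Finset.coe_nonempty.2 hS).mono hSD
    rw [uniformOn, cond_apply hD.measurableSet, Set.inter_eq_self_of_subset_right hSD,
      Measure.count_apply_finset, Measure.count_apply_finite D hD] at h
    set d := hD.toFinset.card with hd
    have hd0 : 0 < d := Finset.card_pos.2 (by simpa using hD0)
    have h1 : (S.card : ℝ≥0∞) ≤ ENNReal.ofReal ε * d := by
      rw [mul_comm, ← div_eq_mul_inv] at h
      exact (ENNReal.div_le_iff (by exact_mod_cast hd0.ne') (ENNReal.natCast_ne_top _)).1 h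
    have h2 := ENNReal.toReal_mono (ENNReal.mul_ne_top ENNReal.ofReal_ne_top
      (ENNReal.natCast_ne_top _)) h1
    rw [ENNReal.toReal_mul, ENNReal.toReal_ofReal hε, ENNReal.toReal_natCast,
      ENNReal.toReal_natCast] at h2
    have h3 : (d : ℝ) ≤ Fintype.card Ω := by exact_mod_cast Finset.card_le_univ _
    exact h2.trans (by gcongr)

theorem matches_of_nearOrthogonal {c : ℝ} {x y : BitString n} (h : NearOrthogonal c x y) (b : Bool) :
    Matches b (ghd c n x y) := by
  obtain ⟨h1, h2⟩ := abs_lt.1 h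
  left
  rw [ghd, if_neg (by linarith), if_neg (by linarith)]

open Classical in
theorem card_not_matches_le {s k : ℕ} {c ε : ℝ} (hε : 0 ≤ ε) (P : Protocol n s k)
    (h : P.HasDistError (ghd c n) (uniformInputs n) (ENNReal.ofReal ε) ∨
      P.HasDistError (ghd c n) (muInputs c n) (ENNReal.ofReal ε)) :
    ((Finset.univ.filter fun p : BitString n × BitString n ↦
      ¬ Matches (P.eval p.1 p.2) (ghd c n p.1 p.2)).card : ℝ) ≤ ε * 4 ^ n := by
  set S := Finset.univ.filter fun p : BitString n × BitString n ↦
      ¬ Matches (P.eval p.1 p.2) (ghd c n p.1 p.2) with hS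
  have hcard : (Fintype.card (BitString n × BitString n) : ℝ) = 4 ^ n := by
    simp only [Fintype.card_prod, Fintype.card_pi, Fintype.card_bool, Finset.prod_const,
      Finset.card_univ, Fintype.card_fin]
    push_cast
    rw [← mul_pow]; norm_num
  have hcoe : (S : Set (BitString n × BitString n)) =
      {p | ¬ Matches (P.eval p.1 p.2) (ghd c n p.1 p.2)} := by
    ext; simp [hS]
  rw [← hcard]
  rcases h with h | h
  · refine card_le_of_uniformOn_le S (Set.subset_univ _) hε ?_
    rw [hcoe]; exact h
  · refine card_le_of_uniformOn_le (D := {p | ¬ NearOrthogonal c p.1 p.2}) S ?_ hε ?_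
    · rw [hcoe]
      exact fun p hp hno ↦ hp (matches_of_nearOrthogonal hno _)
    · rw [hcoe]; exact h

end GapHamming

/-! ### Assembly of the bounds -/

section MainTheorem

theorem two_le_rpow_of_le {δ : ℝ} {t n₁ n : ℕ} (h1 : t / δ ≤ n₁) (hδ : 0 < δ) (hn : n₁ ≤ n) :
    (2 : ℝ) ^ t ≤ 2 ^ (δ * n) := by
  rw [← Real.rpow_natCast 2 t]
  apply Real.rpow_le_rpow_of_exponent_le (by norm_num)
  rw [div_le_iff₀ hδ] at h1
  have : (n₁ : ℝ) ≤ n := by exact_mod_cast hn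
  nlinarith

theorem exists_nat_pow_ge (t n₁ : ℕ) {δ : ℝ} (hδ : 0 < δ) :
    ∃ C₀ : ℕ, ∀ C, C₀ ≤ C → 3 * t / 2 ^ C ≤ δ ∧ n₁ ≤ 2 ^ (C + 1) := by
  obtain ⟨a, ha⟩ := exists_nat_gt (3 * t / δ)
  refine ⟨max a n₁, fun C hC ↦ ⟨?_, ?_⟩⟩
  · have h1 : (a : ℝ) ≤ 2 ^ C := by
      exact_mod_cast ((le_max_left _ _).trans hC).trans Nat.lt_two_pow_self.le
    rw [div_le_iff₀ (by positivity)]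
    rw [div_lt_iff₀ hδ] at ha
    nlinarith
  · have h1 := (le_max_right a n₁).trans hC
    have h2 : C + 1 < 2 ^ (C + 1) := Nat.lt_two_pow_self
    omega

/-- The common structure of the lower bounds: protocols with communication are excluded for large
inputs if they are short, protocols without communication are excluded altogether. -/
theorem div_le_of_bounds {k n s t C n₁ : ℕ} {δ : ℝ} (hC : 3 * t / 2 ^ C ≤ δ)
    (hn₁ : n₁ ≤ 2 ^ (C + 1))
    (hlong : n₁ ≤ n → ¬ (Fintype.card (Leaves s k) : ℝ) ^ t ≤ 2 ^ (δ * n))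
    (htriv : s = 0 ∨ k = 0 → 0 < n → False) :
    (n : ℝ) / 2 ^ ((C + 1) * k ^ 2) ≤ s := by
  rcases Nat.eq_zero_or_pos n with rfl | hn
  · simp
  rcases Nat.eq_zero_or_pos s with hs | hs
  · exact (htriv (Or.inl hs) hn).elim
  rcases Nat.eq_zero_or_pos k with hk | hk
  · exact (htriv (Or.inr hk) hn).elim
  by_contra! hlt
  have hs1 : (1 : ℝ) ≤ s := by exact_mod_cast hs
  -- As `s ≥ 1`, a violation of the bound forces `n` to be large, so `hlong` applies.
  have h1 : (2 : ℝ) ^ ((C + 1) * k ^ 2) ≤ n := by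
    have h2 : (1 : ℝ) ≤ n / 2 ^ ((C + 1) * k ^ 2) := hs1.trans hlt.le
    rwa [le_div_iff₀ (by positivity), one_mul] at h2
  have h3 : 2 ^ (C + 1) ≤ 2 ^ ((C + 1) * k ^ 2) :=
    Nat.pow_le_pow_right (by norm_num) (Nat.le_mul_of_pos_right _ (by positivity))
  have h4 : 2 ^ ((C + 1) * k ^ 2) ≤ n := by exact_mod_cast h1
  exact hlong (hn₁.trans (h3.trans h4)) (card_leaves_pow_le hs hk hC hlt)

/-- The error `ε` does not depend on `k`. Allowing every `C ≥ C₀` lets this bound and the randomized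
one share a constant. -/
theorem exists_distributional_bound (c₀ : ℝ) :
    ∃ (ε : ℝ) (C₀ : ℕ), 0 < ε ∧ ∀ C, C₀ ≤ C → ∀ (k n s : ℕ) (c : ℝ), 0 < c → c ≤ c₀ →
      (2 * c ≤ √(n : ℝ) ∨ (1 ≤ k ∧ 1 ≤ s)) → ∀ P : Protocol n s k,
        (P.HasDistError (ghd c n) (uniformInputs n) (ENNReal.ofReal ε) ∨
          P.HasDistError (ghd c n) (muInputs c n) (ENNReal.ofReal ε)) →
        (n : ℝ) / 2 ^ ((C + 1) * k ^ 2) ≤ s := by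
  classical
  obtain ⟨ε₁, δ, hε₁, hδ, n₀, hcore⟩ := exists_lt_card_gapErrors (2 * c₀)
  obtain ⟨a, ha⟩ := exists_nat_gt ((1 : ℕ) / δ)
  set n₁ := max (max n₀ a) 1 with hn₁
  obtain ⟨C₀, hC₀⟩ := exists_nat_pow_ge 1 n₁ hδ
  -- The second term excludes even a single wrong pair when `n < n₁`. This settles protocols without
  -- communication on short inputs; on longer inputs their two leaves fall under `hlong`.
  refine ⟨min ε₁ (1 / (2 * 4 ^ n₁)), C₀, by positivity, ?_⟩
  intro C hC k n s c hc hcc hnt P hP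
  set ε := min ε₁ (1 / (2 * 4 ^ n₁)) with hε
  obtain ⟨hC1, hC2⟩ := hC₀ C hC
  have hcard := card_not_matches_le (by positivity : 0 ≤ ε) P hP
  have hlong : n₁ ≤ n → ¬ (Fintype.card (Leaves s k) : ℝ) ^ 1 ≤ 2 ^ (δ * n) := by
    intro hn hle
    have hn0 : 0 < n := lt_of_lt_of_le (by positivity) hn
    rw [pow_one] at hle
    have h1 := hcore n (by omega) (Leaves s k) P.leaf Leaves.bit P.isTranscript_leaf hle
    have h2 : (gapErrors (2 * c₀) fun x y ↦ (P.leaf x y).bit) ⊆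
        Finset.univ.filter fun p : BitString n × BitString n ↦
          ¬ Matches (P.eval p.1 p.2) (ghd c n p.1 p.2) := by
      intro p hp
      have h3 := not_matches_of_mem_gapErrors hc hcc hn0 _ hp
      rw [P.bit_leaf] at h3
      exact Finset.mem_filter.2 ⟨Finset.mem_univ _, h3⟩
    have h4 : ((gapErrors (2 * c₀) fun x y ↦ (P.leaf x y).bit).card : ℝ) ≤ ε * 4 ^ n :=
      le_trans (by exact_mod_cast Finset.card_le_card h2) hcard
    have h5 : ε * 4 ^ n ≤ ε₁ * 4 ^ n := by gcongr; exact min_le_left _ _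
    linarith
  refine div_le_of_bounds hC1 hC2 hlong fun hsk hn ↦ ?_
  rcases le_or_gt n₁ n with h | h
  · refine hlong h ?_
    rw [card_leaves_of_trivial hsk]
    exact two_le_rpow_of_le (n₁ := n₁) (le_trans ha.le (by
      have : a ≤ n₁ := by omega
      exact_mod_cast this)) hδ h
  · have hnt' : 2 * c ≤ √(n : ℝ) := hnt.resolve_right (by omega)
    obtain ⟨x, y, x', y', hQ⟩ := exists_inputs_not_matches hsk hc hn hnt'
    have hpos : 1 ≤ (Finset.univ.filter fun p : BitString n × BitString n ↦
        ¬ Matches (P.eval p.1 p.2) (ghd c n p.1 p.2)).card := by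
      rw [Nat.one_le_iff_ne_zero, ← Nat.pos_iff_ne_zero, Finset.card_pos]
      rcases hQ P with h1 | h1
      · exact ⟨(x, y), Finset.mem_filter.2 ⟨Finset.mem_univ _, h1⟩⟩
      · exact ⟨(x', y'), Finset.mem_filter.2 ⟨Finset.mem_univ _, h1⟩⟩
    have hpos' : (1 : ℝ) ≤ ε * 4 ^ n := le_trans (by exact_mod_cast hpos) hcard
    have h6 : ε * 4 ^ n ≤ 1 / (2 * 4 ^ n₁) * 4 ^ n₁ := by
      gcongr
      · exact min_le_right _ _
      · norm_num
    have h7 : 1 / (2 * 4 ^ n₁) * (4 : ℝ) ^ n₁ = 1 / 2 := by field_simp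
    linarith

/-- A randomized protocol without communication has error more than `1 / 3`. -/
theorem RandomizedProtocol.not_hasError_of_trivial {n s k : ℕ} (hsk : s = 0 ∨ k = 0) {c : ℝ}
    (hc : 0 < c) (hn : 0 < n) (h : 2 * c ≤ √(n : ℝ)) (P : RandomizedProtocol n s k) :
    ¬ P.HasError (ghd c n) (1 / 3) := by
  intro hP
  obtain ⟨x, y, x', y', hQ⟩ := exists_inputs_not_matches hsk hc hn h
  have h1 : PMF.toOuterMeasure P Set.univ ≤ 1 / 3 + 1 / 3 := by
    have hcover : (Set.univ : Set (Protocol n s k)) ⊆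
        {Q | ¬ Matches (Q.eval x y) (ghd c n x y)} ∪
          {Q | ¬ Matches (Q.eval x' y') (ghd c n x' y')} := fun Q _ ↦ hQ Q
    exact (measure_mono hcover).trans ((measure_union_le _ _).trans
      (add_le_add (hP x y) (hP x' y')))
  rw [(PMF.toOuterMeasure_apply_eq_one_iff P _).2 (Set.subset_univ _)] at h1
  have h2 := ENNReal.toReal_mono (by finiteness) h1
  rw [ENNReal.toReal_add (by finiteness) (by finiteness)] at h2
  norm_num at h2

theorem exists_randomized_bound (c₀ : ℝ) :
    ∃ C₀ : ℕ, ∀ C, C₀ ≤ C → ∀ (k n s : ℕ) (c : ℝ), 0 < c → c ≤ c₀ →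
      (2 * c ≤ √(n : ℝ) ∨ (1 ≤ k ∧ 1 ≤ s)) → ∀ P : RandomizedProtocol n s k,
        P.HasError (ghd c n) (1 / 3) → (n : ℝ) / 2 ^ ((C + 1) * k ^ 2) ≤ s := by
  classical
  obtain ⟨ε₁, δ, hε₁, hδ, n₀, hcore⟩ := exists_lt_card_gapErrors (2 * c₀)
  obtain ⟨r, hr⟩ := exists_pow_lt_of_lt_one hε₁ (by norm_num : (8 / 9 : ℝ) < 1)
  set n₁ := max n₀ 1 with hn₁
  obtain ⟨C₀, hC₀⟩ := exists_nat_pow_ge (2 * r) n₁ hδ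
  refine ⟨C₀, ?_⟩
  intro C hC k n s c hc hcc hnt P hP
  obtain ⟨hC1, hC2⟩ := hC₀ C hC
  refine div_le_of_bounds hC1 hC2 ?_ fun hsk hn ↦
    P.not_hasError_of_trivial hsk hc hn (hnt.resolve_right (by omega)) hP
  intro hn hle
  have hn0 : 0 < n := lt_of_lt_of_le (by positivity) hn
  obtain ⟨Q, hQ⟩ := PMF.exists_tuple_card_majority_le P
    (fun (Q : Protocol n s k) (p : BitString n × BitString n) ↦
      ¬ Matches (Q.eval p.1 p.2) (ghd c n p.1 p.2)) (fun p ↦ hP p.1 p.2) r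
  let tr : BitString n → BitString n → Fin (2 * r) → Leaves s k := fun x y i ↦ (Q i).leaf x y
  -- A tie gives `false`; in either case a wrong vote means at least `r` wrong protocols out of `2 *
  -- r`.
  let maj : (Fin (2 * r) → Leaves s k) → Bool := fun l ↦
    decide (r < (Finset.univ.filter fun i ↦ (l i).bit = true).card)
  have hcard : (Fintype.card (Fin (2 * r) → Leaves s k) : ℝ) ≤ 2 ^ (δ * n) := by
    rw [Fintype.card_pi_const]
    push_cast
    exact hle
  have h1 := hcore n (by omega) _ tr maj (IsTranscript.pi fun i ↦ (Q i).isTranscript_leaf) hcard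
  have h2 : (gapErrors (2 * c₀) fun x y ↦ maj (tr x y)) ⊆
      Finset.univ.filter fun p : BitString n × BitString n ↦
        r ≤ (Finset.univ.filter fun i ↦
          ¬ Matches ((Q i).eval p.1 p.2) (ghd c n p.1 p.2)).card := by
    intro p hp
    refine Finset.mem_filter.2 ⟨Finset.mem_univ _, ?_⟩
    have hsplit := Finset.card_filter_add_card_filter_not (s := Finset.univ)
      (fun i : Fin (2 * r) ↦ (tr p.1 p.2 i).bit = true)
    rw [Finset.card_univ, Fintype.card_fin] at hsplit
    rcases (Finset.mem_filter.1 hp).2 with ⟨h3, h4⟩ | ⟨h3, h4⟩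
    · rw [ghd_of_two_mul_le hc hcc hn0 h3]
      have h5 : r < (Finset.univ.filter fun i ↦ (tr p.1 p.2 i).bit = true).card := of_decide_eq_true h4
      refine h5.le.trans (Finset.card_le_card fun i hi ↦ ?_)
      have h6 : ((Q i).leaf p.1 p.2).bit = true := (Finset.mem_filter.1 hi).2
      rw [(Q i).bit_leaf] at h6
      refine Finset.mem_filter.2 ⟨Finset.mem_univ _, ?_⟩
      rw [matches_some_iff, h6]
      simp
    · rw [ghd_of_le_neg_two_mul hcc h3]
      have h5 : ¬ r < (Finset.univ.filter fun i ↦ (tr p.1 p.2 i).bit = true).card :=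
        of_decide_eq_false h4
      refine (by omega : r ≤ (Finset.univ.filter fun i ↦
        ¬ (tr p.1 p.2 i).bit = true).card).trans (Finset.card_le_card fun i hi ↦ ?_)
      have h6 : ¬ ((Q i).leaf p.1 p.2).bit = true := (Finset.mem_filter.1 hi).2
      rw [(Q i).bit_leaf] at h6
      refine Finset.mem_filter.2 ⟨Finset.mem_univ _, ?_⟩
      rw [matches_some_iff]
      exact fun h7 ↦ h6 h7.symm
  have h3 : ((gapErrors (2 * c₀) fun x y ↦ maj (tr x y)).card : ℝ) ≤
      (8 / 9) ^ r * Fintype.card (BitString n × BitString n) :=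
    le_trans (by exact_mod_cast Finset.card_le_card h2) hQ
  have h4 : (Fintype.card (BitString n × BitString n) : ℝ) = 4 ^ n := by
    simp only [Fintype.card_prod, Fintype.card_pi, Fintype.card_bool, Finset.prod_const,
      Finset.card_univ, Fintype.card_fin]
    push_cast
    rw [← mul_pow]; norm_num
  rw [h4] at h3
  have h5 : (8 / 9) ^ r * (4 : ℝ) ^ n ≤ ε₁ * 4 ^ n := by gcongr
  linarith

end MainTheorem

theorem mainTheorem1 (c₀ : ℝ) (hc₀ : 0 < c₀) :
    (∃ C : ℕ,
      (∀ (k n s : ℕ) (c : ℝ), 0 < c → c ≤ c₀ →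
        (2 * c ≤ √(n : ℝ) ∨ (1 ≤ k ∧ 1 ≤ s)) →
        ∀ P : RandomizedProtocol n s k, P.HasError (ghd c n) (1 / 3) →
          (n : ℝ) / 2 ^ (C * k ^ 2) ≤ (s : ℝ)) ∧
      (∀ k : ℕ, ∃ ε : ℝ, 0 < ε ∧ ∀ (n s : ℕ) (c : ℝ), 0 < c → c ≤ c₀ →
        (2 * c ≤ √(n : ℝ) ∨ (1 ≤ k ∧ 1 ≤ s)) →
        ∀ P : Protocol n s k,
          (P.HasDistError (ghd c n) (uniformInputs n) (ENNReal.ofReal ε) ∨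
            P.HasDistError (ghd c n) (muInputs c n) (ENNReal.ofReal ε)) →
          (n : ℝ) / 2 ^ (C * k ^ 2) ≤ (s : ℝ))) ∧
    (∀ K : ℕ, ∃ δ : ℝ, 0 < δ ∧ ∃ ε : ℝ, 0 < ε ∧
      ∀ (k n s : ℕ) (c : ℝ), k ≤ K → 0 < c → c ≤ c₀ →
        (2 * c ≤ √(n : ℝ) ∨ (1 ≤ k ∧ 1 ≤ s)) →
        (∀ P : RandomizedProtocol n s k, P.HasError (ghd c n) (1 / 3) → δ * (n : ℝ) ≤ (s : ℝ)) ∧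
        (∀ P : Protocol n s k,
          (P.HasDistError (ghd c n) (uniformInputs n) (ENNReal.ofReal ε) ∨
            P.HasDistError (ghd c n) (muInputs c n) (ENNReal.ofReal ε)) →
          δ * (n : ℝ) ≤ (s : ℝ))) := by
  obtain ⟨ε, C₁, hε, hdist⟩ := exists_distributional_bound c₀
  obtain ⟨C₂, hrand⟩ := exists_randomized_bound c₀
  have hdist' := hdist (max C₁ C₂) (le_max_left _ _)
  have hrand' := hrand (max C₁ C₂) (le_max_right _ _)
  set C := max C₁ C₂ + 1
  refine ⟨⟨C, hrand', fun k ↦ ⟨ε, hε, hdist' k⟩⟩, fun K ↦ ⟨1 / 2 ^ (C * K ^ 2), by positivity, ε, hε,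
    fun k n s c hk hc hcc hnt ↦ ?_⟩⟩
  have hδ : 1 / 2 ^ (C * K ^ 2) * (n : ℝ) ≤ n / 2 ^ (C * k ^ 2) := by
    rw [one_div_mul_eq_div]
    gcongr
    norm_num
  exact ⟨fun P hP ↦ hδ.trans (hrand' k n s c hc hcc hnt P hP),
    fun P hP ↦ hδ.trans (hdist' k n s c hc hcc hnt P hP)⟩
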